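/- Let $0<\alpha<1$, $T>0$, and let $$D_t^\alpha u(t)=\frac1{\Gamma(1-\alpha)}\int_0^t (t-s)^{-\alpha}u'(s)\,ds$$ be the Caputo derivative. For a mesh $0=t_0<t_1<\dots<t_N=T$ the L1 operator is $$\delta_t^\alpha U^m=\frac1{\Gamma(1-\alpha)}\sum_{j=1}^m\frac{U^j-U^{j-1}}{t_j-t_{j-1}}\int_{t_{j-1}}^{t_j}(t_m-s)^{-\alpha}\,ds .$$ For $r\ge1$ and a constant $c$, a mesh $0=s_0<s_1<\dots<s_M=T$ is called quasi-graded (with $M$ intervals) if, with $\tau:=s_1$, $$\tau\simeq M^{-r},\qquad s_j\simeq\tau j^r,\qquad s_j-s_{j-1}\simeq\tau^{1/r}s_j^{1-1/r}\qquad (j=1,\dots,M),$$ where $a\simeq b$ means $a\le cb$ and $b\le ca$. **Theorem.** Given $\alpha\in(0,1)$, $r\ge1$, $T>0$, $c$ and $K$, there is a constant $C$, depending only on these, such that the following holds. Let the temporal mesh $\{t_j\}_{j=0}^N$ of $[0,T]$ either be quasi-graded itself (then $M=N$), or include a quasi-graded submesh of $[0,T]$ with $M$ intervals and with the same first interval (its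 first positive node is $t_1$). Let $u$ be continuous on $[0,T]$ and twice differentiable on $(0,T]$ with $$|u^{(l)}(t)|\le K\,(1+t^{\alpha-l}),\qquad l=1,2,\quad t\in(0,T].$$ Suppose that $D_t^\alpha u(t)=f(t)$ for $t\in(0,T]$, $u(0)=u_0$, and that $\delta_t^\alpha U^m=f(t_m)$ for $m=1,\dots,N$, $U^0=u_0$. Then for all $m=1,\dots,N$ $$|u(t_m)-U^m|\le C\cdot\begin{cases}M^{-r}\,t_m^{\alpha-1}&\text{if }1\le r<2-\alpha,\\ M^{\alpha-2}\,t_m^{\alpha-1}\,[1+\ln(t_m/t_1)]&\text{if }r=2-\alpha,\\ M^{\alpha-2}\,t_m^{\alpha-(2-\alpha)/r}&\text{if }r>2-\alpha.\end{cases}$$ -/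

import Mathlib

open Set

namespace L1Scheme

noncomputable section

/-- The Caputo derivative of order `α ∈ (0,1)`:
`D_t^α u(t) = Γ(1-α)⁻¹ ∫₀ᵗ (t-s)^{-α} u'(s) ds`. -/
def caputo (α : ℝ) (u : ℝ → ℝ) (t : ℝ) : ℝ :=
  1 / Real.Gamma (1 - α) * ∫ s in (0 : ℝ)..t, (t - s) ^ (-α) * deriv u s

/-- The L1 discrete fractional derivative of the grid function `U` on the mesh `t`, at the node
`t m`:
`δ_t^α U^m = Γ(1-α)⁻¹ ∑_{j=1}^m (U^j - U^{j-1})/(t_j - t_{j-1}) ∫_{t_{j-1}}^{t_j} (t_m-s)^{-α} ds`. -/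
def discreteCaputo (α : ℝ) (t : ℕ → ℝ) (U : ℕ → ℝ) (m : ℕ) : ℝ :=
  1 / Real.Gamma (1 - α) * ∑ j ∈ Finset.Icc 1 m,
    (U j - U (j - 1)) / (t j - t (j - 1)) * ∫ s in (t (j - 1))..(t j), (t m - s) ^ (-α)

/-- `0 = t 0 < t 1 < ⋯ < t N = T`. Values of `t` beyond the index `N` play no role. -/
structure IsMesh (T : ℝ) (N : ℕ) (t : ℕ → ℝ) : Prop where
  zero : t 0 = 0
  last : t N = T
  lt_succ : ∀ j, j < N → t j < t (j + 1)

/-- Two-sided comparability `a ≃ b` with an explicit constant `c`. -/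
def Comparable (c a b : ℝ) : Prop := a ≤ c * b ∧ b ≤ c * a

/-- A mesh of `[0,T]` with `M` intervals that is quasi-graded with exponent `r` and constant `c`:
with `τ = t 1`, one has `τ ≃ M^{-r}`, `t_j ≃ τ j^r` and `t_j - t_{j-1} ≃ τ^{1/r} t_j^{1-1/r}`
for `j = 1, …, M`. -/
structure IsQuasiGraded (r c T : ℝ) (M : ℕ) (t : ℕ → ℝ) : Prop where
  isMesh : IsMesh T M t
  first : Comparable c (t 1) ((M : ℝ) ^ (-r))
  node : ∀ j, 1 ≤ j → j ≤ M → Comparable c (t j) (t 1 * (j : ℝ) ^ r)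
  step : ∀ j, 1 ≤ j → j ≤ M →
    Comparable c (t j - t (j - 1)) (t 1 ^ (1 / r) * t j ^ (1 - 1 / r))

/-- The mesh `t` of `[0,T]`, with `N` intervals, includes a quasi-graded mesh of `[0,T]` with `M`
intervals and with the same first interval. -/
def IncludesQuasiGraded (r c T : ℝ) (M N : ℕ) (t : ℕ → ℝ) : Prop :=
  IsMesh T N t ∧ ∃ s : ℕ → ℝ, IsQuasiGraded r c T M s ∧ s 1 = t 1 ∧
    ∀ k, k ≤ M → ∃ j, j ≤ N ∧ s k = t j

/-- `u` is continuous on `[0,T]`, twice differentiable on `(0,T]` (one-sidedly at `T`), and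
`|u^{(l)}(t)| ≤ K (1 + t^{α-l})` for `l = 1, 2` and `t ∈ (0,T]`. -/
structure HasDerivBounds (α K T : ℝ) (u : ℝ → ℝ) : Prop where
  cont : ContinuousOn u (Icc 0 T)
  diff : DifferentiableOn ℝ u (Ioc 0 T)
  diff' : DifferentiableOn ℝ (derivWithin u (Ioc 0 T)) (Ioc 0 T)
  bound : ∀ l : ℕ, l = 1 ∨ l = 2 → ∀ t ∈ Ioc 0 T,
    |iteratedDerivWithin l u (Ioc 0 T) t| ≤ K * (1 + t ^ (α - l))

/-- The pointwise-in-time error bound at the node `tm`, for a mesh with first node `t1` and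
quasi-graded (sub)mesh with `M` intervals and exponent `r`. -/
def errorBound (α r : ℝ) (M : ℕ) (t1 tm : ℝ) : ℝ :=
  if r < 2 - α then (M : ℝ) ^ (-r) * tm ^ (α - 1)
  else if r = 2 - α then (M : ℝ) ^ (α - 2) * tm ^ (α - 1) * (1 + Real.log (tm / t1))
  else (M : ℝ) ^ (α - 2) * tm ^ (α - (2 - α) / r)

end

end L1Scheme

/-!
Error estimate for the L1 scheme on refinements of quasi-graded meshes. Write `τ = t 1`,
`q = (2 - α) / r`, and `k s = (t m - s) ^ (-α)`.

The error `e j = u (t j) - U j` vanishes at `0` and is mapped by the L1 operator to the truncation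
error. The argument combines a bound of the truncation error with a stability estimate for the
operator; both must avoid lower bounds on the mesh steps, since the mesh may be an arbitrary
refinement of a quasi-graded one (`IncludesQuasiGraded.hasGradedSteps` retains the upper bounds).

*Truncation* (`exists_truncation_bound`). On `[a, b]` the derivative of the interpolation error has
mean zero, so `k a` may be subtracted from the kernel. The increment `k s - k a` is at most
`min 1 ((b - a) / (t m - s)) * k s`, which yields second order away from `t m`, and order `2 - α`
close to it, even if the last intervals are much shorter than their neighbours. The outcome is
`(τ / t m) ^ p` for any `p ≤ q` with `p < 1 + α`.

*Stability* (`exists_stability_bound`). The L1 weights increase with the index, so a discrete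
comparison principle holds (`abs_le_of_abs_l1Sum_le`), and it suffices to find barriers. If
`q ≤ α`, the increasing function `s ^ (α - q)` will do. If `q > α`, consider the function which is
linear up to `σ` and equals `s ^ (α - 1)` beyond. Its fractional derivative is known in closed form
and is positive; for `σ ≥ Λ * τ` with a large constant `Λ` it dominates the truncation error of this
function, so that the L1 operator of the barrier is nonnegative at all nodes
(`exists_l1Sum_barrier_nonneg`). At nodes comparable to `σ` it is explicit and of order `1 / σ`.
Summing over dyadic `σ`, with weights matched to `(τ / σ) ^ p`, gives a barrier for right-hand sides
`(τ / t m) ^ p` (`exists_dyadic_stability_bound`), and the geometric sum of the weights produces the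
three cases `q > 1`, `q = 1`, `q < 1`.
-/

namespace L1Scheme

/-! ### The kernel of the fractional derivative -/

theorem intervalIntegrable_kernel {α : ℝ} (hα1 : α < 1) (t a b : ℝ) :
    IntervalIntegrable (fun s : ℝ => (t - s) ^ (-α)) MeasureTheory.volume a b := by
  have := (intervalIntegral.intervalIntegrable_rpow' (by linarith : -1 < -α)
    (a := t - a) (b := t - b)).comp_sub_left t
  simpa using this

theorem integral_kernel {α : ℝ} (hα1 : α < 1) (t a b : ℝ) :
    ∫ s in a..b, (t - s) ^ (-α) = ((t - a) ^ (1 - α) - (t - b) ^ (1 - α)) / (1 - α) := by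
  rw [intervalIntegral.integral_comp_sub_left (fun x : ℝ => x ^ (-α)) t,
    integral_rpow (Or.inl (by linarith))]
  rw [show -α + 1 = 1 - α by ring]

theorem kernel_le_kernel {α : ℝ} (hα0 : 0 ≤ α) {t s s' : ℝ} (hs : s ≤ s') (hs' : s' < t) :
    (t - s) ^ (-α) ≤ (t - s') ^ (-α) :=
  Real.rpow_le_rpow_of_nonpos (by linarith) (by linarith) (by linarith)

theorem sub_mul_kernel_le_integral {α : ℝ} (hα0 : 0 ≤ α) (hα1 : α < 1) {t a b : ℝ}
    (hab : a ≤ b) (hbt : b ≤ t) : (b - a) * (t - a) ^ (-α) ≤ ∫ s in a..b, (t - s) ^ (-α) := by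
  rw [← smul_eq_mul, ← intervalIntegral.integral_const]
  refine intervalIntegral.integral_mono_on_of_le_Ioo hab (by simp)
    (intervalIntegrable_kernel hα1 t a b) fun s hs => ?_
  exact kernel_le_kernel hα0 hs.1.le (hs.2.trans_le hbt)

theorem integral_kernel_le_sub_mul {α : ℝ} (hα0 : 0 ≤ α) (hα1 : α < 1) {t a b : ℝ}
    (hab : a ≤ b) (hbt : b < t) : ∫ s in a..b, (t - s) ^ (-α) ≤ (b - a) * (t - b) ^ (-α) := by
  rw [← smul_eq_mul, ← intervalIntegral.integral_const]
  refine intervalIntegral.integral_mono_on_of_le_Ioo hab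
    (intervalIntegrable_kernel hα1 t a b) (by simp) fun s hs => ?_
  exact kernel_le_kernel hα0 hs.2.le hbt

theorem integral_kernel_pos {α : ℝ} (hα0 : 0 ≤ α) (hα1 : α < 1) {t a b : ℝ}
    (hab : a < b) (hbt : b ≤ t) : 0 < ∫ s in a..b, (t - s) ^ (-α) :=
  (mul_pos (by linarith) (Real.rpow_pos_of_pos (by linarith) _)).trans_le
    (sub_mul_kernel_le_integral hα0 hα1 hab.le hbt)

/-- Concavity of `x ↦ x ^ α` gives the increment of the kernel together with its decay away from
the singularity. -/
theorem kernel_sub_kernel_le {α : ℝ} (hα1 : α ≤ 1) {t a s : ℝ} (has : a ≤ s)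
    (hst : s < t) :
    (t - s) ^ (-α) - (t - a) ^ (-α) ≤ (s - a) / (t - a) * (t - s) ^ (-α) := by
  have h1 : 0 < t - s := by linarith
  have h2 : 0 < t - a := by linarith
  have h3 : (t - a) ^ (-α) = (t - s) ^ (-α) * ((t - s) / (t - a)) ^ α := by
    rw [Real.div_rpow h1.le h2.le, Real.rpow_neg h1.le, Real.rpow_neg h2.le]
    have := Real.rpow_pos_of_pos h1 α
    field_simp
  have h4 : (t - s) / (t - a) ≤ ((t - s) / (t - a)) ^ α := by
    have := Real.rpow_le_rpow_of_exponent_ge (div_pos h1 h2)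
      ((div_le_one h2).2 (by linarith)) hα1
    rwa [Real.rpow_one] at this
  have h5 : (s - a) / (t - a) = 1 - (t - s) / (t - a) := by field_simp; ring
  rw [h3, h5]
  have := mul_le_mul_of_nonneg_left h4 (Real.rpow_pos_of_pos h1 (-α)).le
  linarith

/-- The derivative of the interpolation error has mean zero on each mesh interval, so that a constant
may be subtracted from the kernel. -/
theorem slope_mul_integral_sub_eq {α : ℝ} (hα1 : α < 1) (t : ℝ) {a b : ℝ}
    (hab : a < b) {v : ℝ → ℝ} (hv : ContinuousOn v (Icc a b))
    (hd : DifferentiableOn ℝ v (Ioo a b))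
    (hdv : IntervalIntegrable (deriv v) MeasureTheory.volume a b)
    (hkv : IntervalIntegrable (fun s => (t - s) ^ (-α) * deriv v s) MeasureTheory.volume a b) :
    (v b - v a) / (b - a) * (∫ s in a..b, (t - s) ^ (-α)) -
        ∫ s in a..b, (t - s) ^ (-α) * deriv v s =
      ∫ s in a..b, ((t - s) ^ (-α) - (t - a) ^ (-α)) * ((v b - v a) / (b - a) - deriv v s) := by
  have hk := intervalIntegrable_kernel hα1 t a b
  set q := (v b - v a) / (b - a) with hq
  have hzero : ∫ s in a..b, (q - deriv v s) = 0 := by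
    rw [intervalIntegral.integral_sub intervalIntegrable_const hdv,
      intervalIntegral.integral_eq_sub_of_hasDerivAt_of_le hab.le hv
        (fun x hx => ((hd x hx).differentiableAt (isOpen_Ioo.mem_nhds hx)).hasDerivAt) hdv,
      intervalIntegral.integral_const, hq, smul_eq_mul]
    have : b - a ≠ 0 := by linarith
    field_simp
    ring
  have h1 : ∫ s in a..b, ((t - s) ^ (-α) - (t - a) ^ (-α)) * (q - deriv v s) =
      ((∫ s in a..b, q * (t - s) ^ (-α)) - ∫ s in a..b, (t - s) ^ (-α) * deriv v s) -
        ∫ s in a..b, (t - a) ^ (-α) * (q - deriv v s) := by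
    rw [← intervalIntegral.integral_sub (hk.const_mul _) hkv,
      ← intervalIntegral.integral_sub ((hk.const_mul _).sub hkv)
        ((intervalIntegrable_const.sub hdv).const_mul _)]
    congr 1; ext s; ring
  rw [h1, intervalIntegral.integral_const_mul, intervalIntegral.integral_const_mul, hzero]
  ring

/-- The effect of replacing a function by its linear interpolant on one mesh interval, in terms of
the oscillation of its derivative. -/
theorem abs_slope_mul_integral_sub_le {α : ℝ} (hα0 : 0 ≤ α) (hα1 : α < 1) {t a b ω : ℝ}
    (hab : a < b) (hbt : b ≤ t) {v : ℝ → ℝ} (hv : ContinuousOn v (Icc a b))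
    (hd : DifferentiableOn ℝ v (Ioo a b))
    (hω : ∀ x ∈ Ioo a b, ∀ y ∈ Ioo a b, |deriv v x - deriv v y| ≤ ω) :
    IntervalIntegrable (fun s => (t - s) ^ (-α) * deriv v s) MeasureTheory.volume a b ∧
    |(v b - v a) / (b - a) * (∫ s in a..b, (t - s) ^ (-α)) -
        ∫ s in a..b, (t - s) ^ (-α) * deriv v s| ≤
      ∫ s in a..b, ω * ((t - s) ^ (-α) - (t - a) ^ (-α)) := by
  obtain ⟨ξ, hξ, hslope⟩ := exists_hasDerivAt_eq_slope v (deriv v) hab hv fun x hx =>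
    ((hd x hx).differentiableAt (isOpen_Ioo.mem_nhds hx)).hasDerivAt
  have hk := intervalIntegrable_kernel hα1 t a b
  have hdiff : IntervalIntegrable (fun s => deriv v ξ - deriv v s) MeasureTheory.volume a b := by
    rw [intervalIntegrable_iff_integrableOn_Ioo_of_le hab.le]
    refine MeasureTheory.Measure.integrableOn_of_bounded (M := ω) (by simp)
      (measurable_const.sub (measurable_deriv v)).aestronglyMeasurable ?_
    filter_upwards [MeasureTheory.ae_restrict_mem measurableSet_Ioo] with s hs
    exact hω ξ hξ s hs
  have hkd : IntervalIntegrable (fun s => (t - s) ^ (-α) * (deriv v ξ - deriv v s))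
      MeasureTheory.volume a b := by
    rw [intervalIntegrable_iff_integrableOn_Ioo_of_le hab.le] at hk ⊢
    refine MeasureTheory.Integrable.mul_bdd (c := ω) hk
      (measurable_const.sub (measurable_deriv v)).aestronglyMeasurable ?_
    filter_upwards [MeasureTheory.ae_restrict_mem measurableSet_Ioo] with s hs
    exact hω ξ hξ s hs
  have hkv : IntervalIntegrable (fun s => (t - s) ^ (-α) * deriv v s)
      MeasureTheory.volume a b := by
    have := (hk.mul_const (deriv v ξ)).sub hkd
    convert this using 2
    ring
  refine ⟨hkv, ?_⟩
  have hdv : IntervalIntegrable (deriv v) MeasureTheory.volume a b := by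
    have := (intervalIntegrable_const (c := deriv v ξ)).sub hdiff
    convert this using 2
    ring
  rw [slope_mul_integral_sub_eq hα1 t hab hv hd hdv hkv, ← hslope, ← Real.norm_eq_abs]
  refine intervalIntegral.norm_integral_le_of_norm_le hab.le ?_
    ((hk.sub intervalIntegrable_const).const_mul ω)
  filter_upwards [MeasureTheory.Measure.ae_ne _ b] with s hsb hs
  have hs' : s ∈ Ioo a b := ⟨hs.1, lt_of_le_of_ne hs.2 hsb⟩
  have hnn : 0 ≤ (t - s) ^ (-α) - (t - a) ^ (-α) :=
    sub_nonneg.2 (kernel_le_kernel hα0 hs.1.le (hs'.2.trans_le hbt))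
  rw [norm_mul, Real.norm_of_nonneg hnn, mul_comm]
  exact mul_le_mul_of_nonneg_right (hω ξ hξ s hs') hnn

/-! ### The discrete comparison principle -/

/-- The L1 operator without the factor `Γ(1-α)⁻¹`. -/
noncomputable def l1Sum (α : ℝ) (t V : ℕ → ℝ) (m : ℕ) : ℝ :=
  ∑ j ∈ Finset.Icc 1 m,
    (V j - V (j - 1)) / (t j - t (j - 1)) * ∫ s in (t (j - 1))..(t j), (t m - s) ^ (-α)

theorem discreteCaputo_eq (α : ℝ) (t V : ℕ → ℝ) (m : ℕ) :
    discreteCaputo α t V m = 1 / Real.Gamma (1 - α) * l1Sum α t V m := rfl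

theorem l1Sum_sub (α : ℝ) (t V W : ℕ → ℝ) (m : ℕ) :
    l1Sum α t (fun j => V j - W j) m = l1Sum α t V m - l1Sum α t W m := by
  unfold l1Sum
  rw [← Finset.sum_sub_distrib]
  exact Finset.sum_congr rfl fun j _ => by ring

theorem l1Sum_const_mul (α c : ℝ) (t V : ℕ → ℝ) (m : ℕ) :
    l1Sum α t (fun j => c * V j) m = c * l1Sum α t V m := by
  unfold l1Sum
  rw [Finset.mul_sum]
  exact Finset.sum_congr rfl fun j _ => by ring

theorem l1Sum_sum {ι : Type*} (S : Finset ι) (α : ℝ) (t : ℕ → ℝ) (V : ι → ℕ → ℝ) (m : ℕ) :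
    l1Sum α t (fun j => ∑ i ∈ S, V i j) m = ∑ i ∈ S, l1Sum α t (V i) m := by
  unfold l1Sum
  rw [Finset.sum_comm]
  refine Finset.sum_congr rfl fun j _ => ?_
  rw [← Finset.sum_mul, ← Finset.sum_div, Finset.sum_sub_distrib]

theorem IsMesh.lt {T : ℝ} {N : ℕ} {t : ℕ → ℝ} (h : IsMesh T N t) {i j : ℕ} (hij : i < j)
    (hj : j ≤ N) : t i < t j := by
  induction j, hij using Nat.le_induction with
  | base => exact h.lt_succ i (by omega)
  | succ j hij ih => exact (ih (by omega)).trans (h.lt_succ j (by omega))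

theorem IsMesh.le {T : ℝ} {N : ℕ} {t : ℕ → ℝ} (h : IsMesh T N t) {i j : ℕ} (hij : i ≤ j)
    (hj : j ≤ N) : t i ≤ t j := by
  rcases hij.eq_or_lt with rfl | hij
  · exact le_rfl
  · exact (h.lt hij hj).le

theorem IsMesh.pos {T : ℝ} {N : ℕ} {t : ℕ → ℝ} (h : IsMesh T N t) {j : ℕ} (hj0 : 1 ≤ j)
    (hj : j ≤ N) : 0 < t j := by
  have := h.lt (i := 0) (by omega) hj
  rwa [h.zero] at this

/-- Summation by parts for increasing weights. -/
theorem sum_sub_mul_le {m : ℕ} {w a : ℕ → ℝ} (hw : ∀ j < m, 0 ≤ w j) (ha : 0 ≤ a 1)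
    (hmono : ∀ j, 1 ≤ j → j < m → a j ≤ a (j + 1)) {n : ℕ} (hn : 1 ≤ n) (hnm : n ≤ m) :
    ∑ j ∈ Finset.Icc 1 n, (w j - w (j - 1)) * a j ≤ w n * a n := by
  induction n, hn using Nat.le_induction with
  | base =>
    have := mul_nonneg (hw 0 (by omega)) ha
    simp only [Finset.Icc_self, Finset.sum_singleton, Nat.sub_self]
    linarith
  | succ n hn ih =>
    rw [Finset.sum_Icc_succ_top (by omega)]
    have h1 := ih (by omega)
    have h2 := mul_le_mul_of_nonneg_left (hmono n hn (by omega)) (hw n (by omega))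
    simp only [Nat.add_sub_cancel]
    linarith

theorem nonneg_of_l1Sum_nonneg {α T : ℝ} {N : ℕ} {t : ℕ → ℝ} (hα0 : 0 ≤ α) (hα1 : α < 1)
    (ht : IsMesh T N t) {W : ℕ → ℝ} (h0 : 0 ≤ W 0) {m : ℕ} (hm : m ≤ N)
    (h : ∀ i, 1 ≤ i → i ≤ m → 0 ≤ l1Sum α t W i) : 0 ≤ W m := by
  induction m using Nat.strong_induction_on with
  | _ m ih =>
  rcases Nat.eq_zero_or_pos m with rfl | hm0
  · exact h0
  have hw : ∀ j < m, 0 ≤ W j := fun j hj =>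
    ih j hj (by omega) fun i hi hij => h i hi (by omega)
  -- the weights are means of an increasing kernel over consecutive intervals
  set a : ℕ → ℝ := fun j => (∫ s in (t (j - 1))..(t j), (t m - s) ^ (-α)) / (t j - t (j - 1))
    with ha
  have hlt : ∀ j, 1 ≤ j → j ≤ m → t (j - 1) < t j := fun j h1 h2 =>
    ht.lt (by omega) (by omega)
  have hpos : ∀ j, 1 ≤ j → j ≤ m → 0 < a j := fun j h1 h2 =>
    div_pos (integral_kernel_pos hα0 hα1 (hlt j h1 h2) (ht.le h2 hm))
      (sub_pos.2 (hlt j h1 h2))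
  have hmono : ∀ j, 1 ≤ j → j < m → a j ≤ a (j + 1) := by
    intro j h1 h2
    have hA : a j ≤ (t m - t j) ^ (-α) := by
      rw [ha, div_le_iff₀ (sub_pos.2 (hlt j h1 h2.le)), mul_comm]
      exact integral_kernel_le_sub_mul hα0 hα1 (hlt j h1 h2.le).le (ht.lt h2 hm)
    refine hA.trans ?_
    have hlt' := hlt (j + 1) (by omega) h2
    simp only [Nat.add_sub_cancel, ha] at hlt' ⊢
    rw [le_div_iff₀ (sub_pos.2 hlt'), mul_comm]
    exact sub_mul_kernel_le_integral hα0 hα1 hlt'.le (ht.le h2 hm)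
  have h1 := sum_sub_mul_le hw (hpos 1 le_rfl hm0).le hmono hm0 le_rfl
  have h2 : l1Sum α t W m = ∑ j ∈ Finset.Icc 1 m, (W j - W (j - 1)) * a j :=
    Finset.sum_congr rfl fun j _ => by rw [ha]; ring
  have h3 := h m hm0 le_rfl
  rw [h2] at h3
  exact nonneg_of_mul_nonneg_left (h3.trans h1) (hpos m hm0 le_rfl)

theorem abs_le_of_abs_l1Sum_le {α T : ℝ} {N : ℕ} {t : ℕ → ℝ} (hα0 : 0 ≤ α) (hα1 : α < 1)
    (ht : IsMesh T N t) {V W : ℕ → ℝ} (hV : V 0 = 0) (hW : 0 ≤ W 0) {m : ℕ} (hm : m ≤ N)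
    (h : ∀ i, 1 ≤ i → i ≤ m → |l1Sum α t V i| ≤ l1Sum α t W i) : |V m| ≤ W m := by
  have h1 : 0 ≤ W m - V m :=
    nonneg_of_l1Sum_nonneg (W := fun j => W j - V j) hα0 hα1 ht (by simpa [hV]) hm
      fun i hi him => by
        rw [l1Sum_sub]; linarith [le_abs_self (l1Sum α t V i), h i hi him]
  have h2 : 0 ≤ W m - (-1) * V m :=
    nonneg_of_l1Sum_nonneg (W := fun j => W j - (-1) * V j) hα0 hα1 ht (by simpa [hV]) hm
      fun i hi him => by
        rw [l1Sum_sub, l1Sum_const_mul]; linarith [neg_abs_le (l1Sum α t V i), h i hi him]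
  exact abs_le.2 ⟨by linarith, by linarith⟩

/-! ### Interpolation errors on a graded mesh -/

/-- The steps of a mesh beyond the first interval obey an upper bound of graded type: a step
starting at `a` has length at most `C * a * (t 1 / a) ^ θ`, where `θ = 1 / r`, and its endpoints are
comparable. No lower bound is asked for, so that the property survives refinement. -/
structure HasGradedSteps (θ C : ℝ) (N : ℕ) (t : ℕ → ℝ) : Prop where
  ratio : ∀ j, 1 ≤ j → j < N → t (j + 1) ≤ C * t j
  step : ∀ j, 1 ≤ j → j < N → t (j + 1) - t j ≤ C * (t j * (t 1 / t j) ^ θ)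

/-- An integrable majorant of `(b - a) * a ^ (-μ) * ((t - s) ^ (-α) - (t - a) ^ (-α))` for `s` in a
mesh interval `(a, b)`; the first term is in charge of `s ≤ t / 2`, the second of `s > t / 2`. -/
noncomputable def majorant (α θ μ e C τ t s : ℝ) : ℝ :=
  t ^ (-α - 1) * (τ ^ e * s ^ (2 - μ - e)) +
    t ^ (-μ) * (C * (t * (τ / t) ^ θ) *
      (min 1 (C * (t * (τ / t) ^ θ) / (t - s)) * (t - s) ^ (-α)))

theorem mul_div_rpow_le {θ τ a s : ℝ} (hθ : θ ≤ 1) (hτ : 0 < τ) (ha : 0 < a) (has : a ≤ s) :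
    a * (τ / a) ^ θ ≤ s * (τ / s) ^ θ := by
  have key : ∀ x : ℝ, 0 < x → x * (τ / x) ^ θ = x ^ (1 - θ) * τ ^ θ := fun x hx => by
    rw [Real.div_rpow hτ.le hx.le, Real.rpow_sub hx, Real.rpow_one]
    ring
  rw [key a ha, key s (ha.trans_le has)]
  have := Real.rpow_le_rpow ha.le has (by linarith : 0 ≤ 1 - θ)
  gcongr

theorem sub_mul_kernel_sub_le_majorant {α θ μ e C τ t a b s : ℝ} (hα0 : 0 < α) (hα1 : α < 1)
    (hθ : θ ≤ 1) (hμ : 0 ≤ μ) (he : e ≤ 2 * θ) (hC : 1 ≤ C) (hτ : 0 < τ) (hτa : τ ≤ a)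
    (hbt : b ≤ t) (hratio : b ≤ C * a) (hstep : b - a ≤ C * (a * (τ / a) ^ θ))
    (hs : s ∈ Ioo a b) :
    (b - a) * a ^ (-μ) * ((t - s) ^ (-α) - (t - a) ^ (-α)) ≤
      (C ^ μ * C ^ 2 * 2 ^ (α + 1) + C ^ μ * 2 ^ μ) * majorant α θ μ e C τ t s := by
  have has := hs.1
  have hsb := hs.2
  have ha : 0 < a := hτ.trans_le hτa
  have hs0 : 0 < s := ha.trans has
  have ht0 : 0 < t := by linarith
  have hst : 0 < t - s := by linarith
  have hC0 : 0 < C := by linarith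
  have hX0 : 0 ≤ (t - s) ^ (-α) - (t - a) ^ (-α) :=
    sub_nonneg.2 (kernel_le_kernel hα0.le has.le (by linarith))
  have hX := kernel_sub_kernel_le hα1.le has.le (by linarith : s < t)
  set X := (t - s) ^ (-α) - (t - a) ^ (-α) with hXdef
  have hk0 : 0 < (t - s) ^ (-α) := Real.rpow_pos_of_pos hst _
  have hh : b - a ≤ C * (s * (τ / s) ^ θ) :=
    hstep.trans (mul_le_mul_of_nonneg_left (mul_div_rpow_le hθ hτ ha has.le) hC0.le)
  have haμ : a ^ (-μ) ≤ C ^ μ * s ^ (-μ) := by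
    have h1 : a ^ (-μ) ≤ (s / C) ^ (-μ) :=
      Real.rpow_le_rpow_of_nonpos (by positivity)
        ((div_le_iff₀ hC0).2 (by nlinarith)) (by linarith)
    rwa [Real.div_rpow hs0.le hC0.le, Real.rpow_neg hC0.le, div_inv_eq_mul, mul_comm] at h1
  have hfrac : (s - a) / (t - a) ≤ (b - a) / (t - s) := by gcongr; linarith
  have hM1 : 0 ≤ t ^ (-α - 1) * (τ ^ e * s ^ (2 - μ - e)) := by positivity
  have hM2 : 0 ≤ t ^ (-μ) * (C * (t * (τ / t) ^ θ) *
      (min 1 (C * (t * (τ / t) ^ θ) / (t - s)) * (t - s) ^ (-α))) := by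
    have : 0 ≤ min 1 (C * (t * (τ / t) ^ θ) / (t - s)) := by positivity
    positivity
  unfold majorant
  rcases le_or_gt s (t / 2) with h2 | h2
  · -- away from the singularity: one power of the step is gained from the smooth kernel
    have h3 : (t - s) ^ (-α) / (t - s) ≤ 2 ^ (α + 1) * t ^ (-α - 1) := by
      have h4 : (t - s) ^ (-α) / (t - s) = (t - s) ^ (-α - 1) := by
        rw [Real.rpow_sub hst, Real.rpow_one]
      rw [h4]
      refine (Real.rpow_le_rpow_of_nonpos (by positivity : 0 < t / 2) (by linarith)
        (by linarith)).trans (le_of_eq ?_)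
      rw [Real.div_rpow ht0.le (by norm_num), show -α - 1 = -(α + 1) by ring,
        Real.rpow_neg (by norm_num : (0 : ℝ) ≤ 2), div_inv_eq_mul, mul_comm]
    have h5 : X ≤ (b - a) * (2 ^ (α + 1) * t ^ (-α - 1)) := by
      calc X ≤ (s - a) / (t - a) * (t - s) ^ (-α) := hX
        _ ≤ (b - a) / (t - s) * (t - s) ^ (-α) := by gcongr
        _ = (b - a) * ((t - s) ^ (-α) / (t - s)) := by ring
        _ ≤ _ := by
          have : 0 ≤ b - a := by linarith
          gcongr
    have h6 : (τ / s) ^ (2 * θ) ≤ (τ / s) ^ e :=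
      Real.rpow_le_rpow_of_exponent_ge (by positivity)
        ((div_le_one hs0).2 (by linarith)) he
    have h7 : (b - a) ^ 2 ≤ C ^ 2 * (s ^ 2 * (τ / s) ^ e) := by
      calc (b - a) ^ 2 ≤ (C * (s * (τ / s) ^ θ)) ^ 2 :=
            pow_le_pow_left₀ (by linarith) hh 2
        _ = C ^ 2 * (s ^ 2 * (τ / s) ^ (2 * θ)) := by
            rw [mul_comm 2 θ, Real.rpow_mul (by positivity), Real.rpow_two]; ring
        _ ≤ _ := by gcongr
    have h8 : s ^ 2 * (τ / s) ^ e * s ^ (-μ) = τ ^ e * s ^ (2 - μ - e) := by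
      rw [Real.div_rpow hτ.le hs0.le, Real.rpow_sub hs0, Real.rpow_sub hs0, Real.rpow_neg hs0.le,
        Real.rpow_two]
      field_simp
    calc (b - a) * a ^ (-μ) * X
        ≤ (b - a) * (C ^ μ * s ^ (-μ)) * ((b - a) * (2 ^ (α + 1) * t ^ (-α - 1))) := by
          have : 0 ≤ b - a := by linarith
          gcongr
      _ = (b - a) ^ 2 * (C ^ μ * s ^ (-μ) * (2 ^ (α + 1) * t ^ (-α - 1))) := by ring
      _ ≤ C ^ 2 * (s ^ 2 * (τ / s) ^ e) * (C ^ μ * s ^ (-μ) * (2 ^ (α + 1) * t ^ (-α - 1))) := by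
          gcongr
      _ = C ^ μ * C ^ 2 * 2 ^ (α + 1) * (t ^ (-α - 1) * (s ^ 2 * (τ / s) ^ e * s ^ (-μ))) := by
          ring
      _ = C ^ μ * C ^ 2 * 2 ^ (α + 1) * (t ^ (-α - 1) * (τ ^ e * s ^ (2 - μ - e))) := by
          rw [h8]
      _ ≤ _ := mul_le_mul (le_add_of_nonneg_right (by positivity))
          (le_add_of_nonneg_right hM2) hM1 (by positivity)
  · set η := C * (t * (τ / t) ^ θ) with hη
    have hη0 : 0 < η := by positivity
    have hhη : b - a ≤ η :=
      hh.trans (mul_le_mul_of_nonneg_left (mul_div_rpow_le hθ hτ hs0 (by linarith)) hC0.le)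
    have h3 : X ≤ min 1 (η / (t - s)) * (t - s) ^ (-α) := by
      refine hX.trans (mul_le_mul_of_nonneg_right (le_min ?_ ?_) hk0.le)
      · exact (div_le_one (by linarith)).2 (by linarith)
      · exact hfrac.trans (by gcongr)
    have h4 : s ^ (-μ) ≤ 2 ^ μ * t ^ (-μ) := by
      have h1 : s ^ (-μ) ≤ (t / 2) ^ (-μ) :=
        Real.rpow_le_rpow_of_nonpos (by positivity) h2.le (by linarith)
      rwa [Real.div_rpow ht0.le (by norm_num), Real.rpow_neg (by norm_num : (0 : ℝ) ≤ 2),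
        div_inv_eq_mul, mul_comm] at h1
    calc (b - a) * a ^ (-μ) * X
        ≤ η * (C ^ μ * (2 ^ μ * t ^ (-μ))) * (min 1 (η / (t - s)) * (t - s) ^ (-α)) := by
          refine mul_le_mul (mul_le_mul hhη (haμ.trans ?_) (by positivity) hη0.le) h3 hX0
            (by positivity)
          gcongr
      _ = C ^ μ * 2 ^ μ * (t ^ (-μ) * (η * (min 1 (η / (t - s)) * (t - s) ^ (-α)))) := by ring
      _ ≤ _ := mul_le_mul (le_add_of_nonneg_left (by positivity))
          (le_add_of_nonneg_left hM1) hM2 (by positivity)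

theorem intervalIntegrable_min_kernel {α : ℝ} (hα1 : α < 1) (η t : ℝ) {a b : ℝ} (hη : 0 ≤ η)
    (hab : a ≤ b) (hbt : b ≤ t) :
    IntervalIntegrable (fun s => min 1 (η / (t - s)) * (t - s) ^ (-α))
      MeasureTheory.volume a b := by
  have hk := intervalIntegrable_kernel hα1 t a b
  rw [intervalIntegrable_iff_integrableOn_Ioo_of_le hab] at hk ⊢
  refine MeasureTheory.Integrable.bdd_mul (c := 1) hk
    (by fun_prop : Measurable fun s : ℝ => min 1 (η / (t - s))).aestronglyMeasurable ?_
  filter_upwards [MeasureTheory.ae_restrict_mem measurableSet_Ioo] with s hs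
  have : 0 ≤ η / (t - s) := div_nonneg hη (by linarith [hs.2])
  rw [Real.norm_of_nonneg (le_min zero_le_one this)]
  exact min_le_left _ _

theorem integral_min_kernel_le {α : ℝ} (hα0 : 0 < α) (hα1 : α < 1) {η t l : ℝ} (hη : 0 < η)
    (hl : l ≤ t) :
    ∫ s in l..t, min 1 (η / (t - s)) * (t - s) ^ (-α) ≤
      η ^ (1 - α) * (1 / (1 - α) + 1 / α) := by
  have h1α : 0 < 1 - α := by linarith
  -- near the singularity the minimum is replaced by `1`
  have near : ∀ c, c ≤ t → t - c ≤ η →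
      ∫ s in c..t, min 1 (η / (t - s)) * (t - s) ^ (-α) ≤ η ^ (1 - α) * (1 / (1 - α)) := by
    intro c hc hcη
    calc ∫ s in c..t, min 1 (η / (t - s)) * (t - s) ^ (-α)
        ≤ ∫ s in c..t, (t - s) ^ (-α) := by
          refine intervalIntegral.integral_mono_on_of_le_Ioo hc
            (intervalIntegrable_min_kernel hα1 η t hη.le hc le_rfl)
            (intervalIntegrable_kernel hα1 t c t) fun s hs => ?_
          exact mul_le_of_le_one_left (Real.rpow_nonneg (by linarith [hs.2]) _) (min_le_left _ _)
      _ = (t - c) ^ (1 - α) / (1 - α) := by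
          rw [integral_kernel hα1, sub_self, Real.zero_rpow h1α.ne', sub_zero]
      _ ≤ _ := by
          rw [div_eq_mul_one_div]
          gcongr
  rcases le_or_gt (t - l) η with h | h
  · refine (near l hl h).trans ?_
    have : 0 < 1 / α := by positivity
    gcongr
    linarith
  · rw [← intervalIntegral.integral_add_adjacent_intervals (b := t - η)
      (intervalIntegrable_min_kernel hα1 η t hη.le (by linarith) (by linarith))
      (intervalIntegrable_min_kernel hα1 η t hη.le (by linarith) le_rfl), mul_add, add_comm]
    refine add_le_add (near _ (by linarith) (by linarith)) ?_
    have hint : IntervalIntegrable (fun s => η * (t - s) ^ (-α - 1)) MeasureTheory.volume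
        l (t - η) := by
      refine ContinuousOn.intervalIntegrable (continuousOn_const.mul
        ((by fun_prop : ContinuousOn (fun s : ℝ => t - s) _).rpow_const fun s hs => Or.inl ?_))
      rw [uIcc_of_le (by linarith)] at hs
      linarith [hs.2]
    calc ∫ s in l..(t - η), min 1 (η / (t - s)) * (t - s) ^ (-α)
        ≤ ∫ s in l..(t - η), η * (t - s) ^ (-α - 1) := by
          refine intervalIntegral.integral_mono_on_of_le_Ioo (by linarith)
            (intervalIntegrable_min_kernel hα1 η t hη.le (by linarith) (by linarith))
            hint fun s hs => ?_
          have hts : 0 < t - s := by linarith [hs.2]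
          rw [Real.rpow_sub hts, Real.rpow_one]
          calc _ ≤ η / (t - s) * (t - s) ^ (-α) := by
                gcongr
                exact min_le_right _ _
            _ = _ := by ring
      _ = η * ((η ^ (-α) - (t - l) ^ (-α)) / α) := by
          rw [intervalIntegral.integral_const_mul,
            intervalIntegral.integral_comp_sub_left (fun x : ℝ => x ^ (-α - 1)) t,
            integral_rpow (Or.inr ⟨by linarith, ?_⟩)]
          · rw [show -α - 1 + 1 = -α by ring, sub_sub_cancel, div_neg, ← neg_div, neg_sub]
          · rw [sub_sub_cancel, uIcc_of_le h.le]
            exact fun h0 => absurd h0.1 (by linarith)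
      _ ≤ η * (η ^ (-α) / α) := by
          have : 0 ≤ (t - l) ^ (-α) := Real.rpow_nonneg (by linarith) _
          gcongr
          linarith
      _ = η ^ (1 - α) * (1 / α) := by
          rw [sub_eq_add_neg, Real.rpow_add hη, Real.rpow_one]; ring

theorem intervalIntegrable_majorant {α θ μ e C τ t a b : ℝ} (hα1 : α < 1) (hC : 0 ≤ C)
    (hτ : 0 < τ) (ha : 0 < a) (hab : a ≤ b) (hbt : b ≤ t) :
    IntervalIntegrable (majorant α θ μ e C τ t) MeasureTheory.volume a b := by
  have ht : 0 < t := by linarith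
  have h0 : 0 ≤ C * (t * (τ / t) ^ θ) := by positivity
  refine IntervalIntegrable.add ?_
    (((intervalIntegrable_min_kernel hα1 _ t h0 hab hbt).const_mul _).const_mul _)
  refine ContinuousOn.intervalIntegrable (continuousOn_const.mul (continuousOn_const.mul
    (continuousOn_id.rpow_const fun s hs => Or.inl ?_)))
  rw [uIcc_of_le hab] at hs
  exact (ha.trans_le hs.1).ne'

theorem integral_majorant_le {α θ μ e C τ t l : ℝ} (hα0 : 0 < α) (hα1 : α < 1) (hC : 0 < C)
    (hτ : 0 < τ) (hl : 0 < l) (hlt : l ≤ t) :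
    ∫ s in l..t, majorant α θ μ e C τ t s ≤
      t ^ (-α - 1) * (τ ^ e * ∫ s in l..t, s ^ (2 - μ - e)) +
        C ^ (2 - α) * (1 / (1 - α) + 1 / α) *
          (t ^ (2 - α - μ) * (τ / t) ^ ((2 - α) * θ)) := by
  have ht : 0 < t := by linarith
  have hη : 0 < C * (t * (τ / t) ^ θ) := by positivity
  unfold majorant
  rw [intervalIntegral.integral_add, intervalIntegral.integral_const_mul,
    intervalIntegral.integral_const_mul, intervalIntegral.integral_const_mul,
    intervalIntegral.integral_const_mul]
  · refine add_le_add le_rfl ?_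
    calc t ^ (-μ) * (C * (t * (τ / t) ^ θ) * ∫ s in l..t,
          (min 1 (C * (t * (τ / t) ^ θ) / (t - s)) * (t - s) ^ (-α)))
        ≤ t ^ (-μ) * (C * (t * (τ / t) ^ θ) *
          ((C * (t * (τ / t) ^ θ)) ^ (1 - α) * (1 / (1 - α) + 1 / α))) := by
          gcongr
          exact integral_min_kernel_le hα0 hα1 hη hlt
      _ = t ^ (-μ) * ((C * (t * (τ / t) ^ θ)) ^ (2 - α) * (1 / (1 - α) + 1 / α)) := by
          rw [show 2 - α = 1 + (1 - α) by ring, Real.rpow_add hη, Real.rpow_one]; ring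
      _ = _ := by
          rw [Real.mul_rpow hC.le (by positivity), Real.mul_rpow ht.le (by positivity),
            ← Real.rpow_mul (by positivity), mul_comm θ, show 2 - α - μ = (2 - α) + (-μ) by ring,
            Real.rpow_add ht (2 - α) (-μ)]
          ring
  · refine ContinuousOn.intervalIntegrable (continuousOn_const.mul (continuousOn_const.mul
      (continuousOn_id.rpow_const fun s hs => Or.inl ?_)))
    rw [uIcc_of_le hlt] at hs
    exact (hl.trans_le hs.1).ne'
  · exact (((intervalIntegrable_min_kernel hα1 _ t hη.le hlt le_rfl).const_mul _).const_mul _)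

/-- The interpolation error on one interval `[a, b]` of a graded mesh, for a function whose second
derivative is of order `a ^ (-μ)` there. -/
theorem abs_slope_mul_integral_sub_le_majorant {α θ μ e C τ t a b A : ℝ} (hα0 : 0 < α)
    (hα1 : α < 1) (hθ : θ ≤ 1) (hμ : 0 ≤ μ) (he : e ≤ 2 * θ) (hC : 1 ≤ C) (hτ : 0 < τ)
    (hτa : τ ≤ a) (hab : a < b) (hbt : b ≤ t) (hratio : b ≤ C * a)
    (hstep : b - a ≤ C * (a * (τ / a) ^ θ)) (hA : 0 ≤ A)
    {v v₂ : ℝ → ℝ} (hv : ContinuousOn v (Icc a b))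
    (hd : DifferentiableOn ℝ v (Ioo a b)) (hd₂ : ∀ x ∈ Ioo a b, HasDerivAt (deriv v) (v₂ x) x)
    (hb : ∀ x ∈ Ioo a b, |v₂ x| ≤ A * a ^ (-μ)) :
    IntervalIntegrable (fun s => (t - s) ^ (-α) * deriv v s) MeasureTheory.volume a b ∧
    |(v b - v a) / (b - a) * (∫ s in a..b, (t - s) ^ (-α)) -
        ∫ s in a..b, (t - s) ^ (-α) * deriv v s| ≤
      A * (C ^ μ * C ^ 2 * 2 ^ (α + 1) + C ^ μ * 2 ^ μ) *
        ∫ s in a..b, majorant α θ μ e C τ t s := by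
  have ha : 0 < a := hτ.trans_le hτa
  have hω : ∀ x ∈ Ioo a b, ∀ y ∈ Ioo a b,
      |deriv v x - deriv v y| ≤ A * ((b - a) * a ^ (-μ)) := by
    intro x hx y hy
    have h1 := (convex_Ioo a b).norm_image_sub_le_of_norm_hasDerivWithin_le
      (fun z hz => (hd₂ z hz).hasDerivWithinAt) hb hy hx
    have h2 : ‖x - y‖ ≤ b - a :=
      abs_le.2 ⟨by linarith [hx.1, hy.2], by linarith [hx.2, hy.1]⟩
    refine h1.trans ((mul_le_mul_of_nonneg_left h2 (by positivity)).trans (le_of_eq (by ring)))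
  obtain ⟨h1, h2⟩ := abs_slope_mul_integral_sub_le hα0.le hα1 hab hbt hv hd hω
  refine ⟨h1, h2.trans ?_⟩
  rw [← intervalIntegral.integral_const_mul]
  refine intervalIntegral.integral_mono_on_of_le_Ioo hab.le
    (((intervalIntegrable_kernel hα1 t a b).sub intervalIntegrable_const).const_mul _)
    ((intervalIntegrable_majorant hα1 (by linarith) hτ ha hab.le hbt).const_mul _)
    fun s hs => ?_
  have := mul_le_mul_of_nonneg_left (sub_mul_kernel_sub_le_majorant (s := s) hα0 hα1 hθ hμ he hC hτ
    hτa hbt hratio hstep hs) hA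
  calc _ = A * ((b - a) * a ^ (-μ) * ((t - s) ^ (-α) - (t - a) ^ (-α))) := by ring
    _ ≤ _ := this
    _ = _ := by ring

/-! ### The truncation error -/

/-- The error on the first mesh interval, where only `|v'| ≤ A * s ^ (α - 1)` is available. The
power `1 + α` comes from the kernel alone: `k s - k 0 ≤ (s / t) * k s` for `k s = (t - s) ^ (-α)`,
and `t - s ≥ (t / τ) * (τ - s)`. -/
theorem abs_slope_mul_integral_sub_le_of_first {α τ t A : ℝ} (hα0 : 0 < α) (hα1 : α < 1)
    (hτ : 0 < τ) (hτt : τ ≤ t) (hA : 0 ≤ A) {v : ℝ → ℝ} (hv : ContinuousOn v (Icc 0 τ))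
    (hd : DifferentiableOn ℝ v (Ioo 0 τ)) (hb : ∀ x ∈ Ioo 0 τ, |deriv v x| ≤ A * x ^ (α - 1)) :
    IntervalIntegrable (fun s => (t - s) ^ (-α) * deriv v s) MeasureTheory.volume 0 τ ∧
    |(v τ - v 0) / (τ - 0) * (∫ s in (0 : ℝ)..τ, (t - s) ^ (-α)) -
        ∫ s in (0 : ℝ)..τ, (t - s) ^ (-α) * deriv v s| ≤
      A * ((1 / α + 2 ^ (1 - α)) / (1 - α) + 2 ^ α / α) * (τ / t) ^ (1 + α) := by
  have h1α : 0 < 1 - α := by linarith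
  have ht : 0 < t := hτ.trans_le hτt
  have hpow : IntervalIntegrable (fun s : ℝ => s ^ (α - 1)) MeasureTheory.volume 0 τ :=
    intervalIntegral.intervalIntegrable_rpow' (by linarith)
  set φ : ℝ → ℝ := fun s => (1 / α + 2 ^ (1 - α)) * τ ^ (α - 1) * (τ - s) ^ (-α) +
    2 ^ α * τ ^ (-α) * s ^ (α - 1) with hφ
  have hφint : IntervalIntegrable φ MeasureTheory.volume 0 τ :=
    ((intervalIntegrable_kernel hα1 τ 0 τ).const_mul _).add (hpow.const_mul _)
  -- the two singularities are separated at `τ / 2`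
  have hφle : ∀ s ∈ Ioo 0 τ, (τ - s) ^ (-α) * (1 / α * τ ^ (α - 1) + s ^ (α - 1)) ≤ φ s := by
    intro s hs
    have hτs : 0 < τ - s := by linarith [hs.2]
    have hs0 := hs.1
    have key : (τ - s) ^ (-α) * s ^ (α - 1) ≤
        2 ^ (1 - α) * τ ^ (α - 1) * (τ - s) ^ (-α) + 2 ^ α * τ ^ (-α) * s ^ (α - 1) := by
      rcases le_total s (τ / 2) with h | h
      · have : (τ - s) ^ (-α) ≤ (τ / 2) ^ (-α) :=
          Real.rpow_le_rpow_of_nonpos (by positivity) (by linarith) (by linarith)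
        rw [Real.div_rpow hτ.le (by norm_num), Real.rpow_neg (by norm_num : (0 : ℝ) ≤ 2),
          div_inv_eq_mul] at this
        calc _ ≤ τ ^ (-α) * 2 ^ α * s ^ (α - 1) := by gcongr
          _ = 2 ^ α * τ ^ (-α) * s ^ (α - 1) := by ring
          _ ≤ _ := le_add_of_nonneg_left (by positivity)
      · have : s ^ (α - 1) ≤ (τ / 2) ^ (α - 1) :=
          Real.rpow_le_rpow_of_nonpos (by positivity) h (by linarith)
        rw [Real.div_rpow hτ.le (by norm_num), show α - 1 = -(1 - α) by ring,
          Real.rpow_neg (by norm_num : (0 : ℝ) ≤ 2), div_inv_eq_mul,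
          show -(1 - α) = α - 1 by ring] at this
        calc _ ≤ (τ - s) ^ (-α) * (τ ^ (α - 1) * 2 ^ (1 - α)) := by gcongr
          _ = 2 ^ (1 - α) * τ ^ (α - 1) * (τ - s) ^ (-α) := by ring
          _ ≤ _ := le_add_of_nonneg_right (by positivity)
    rw [hφ]
    simp only
    linarith
  have hφval : ∫ s in (0 : ℝ)..τ, φ s = (1 / α + 2 ^ (1 - α)) / (1 - α) + 2 ^ α / α := by
    rw [hφ, intervalIntegral.integral_add ((intervalIntegrable_kernel hα1 τ 0 τ).const_mul _)
      (hpow.const_mul _), intervalIntegral.integral_const_mul, intervalIntegral.integral_const_mul,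
      integral_kernel hα1, integral_rpow (Or.inl (by linarith)), sub_self, sub_zero,
      Real.zero_rpow h1α.ne', show α - 1 + 1 = α by ring, Real.zero_rpow hα0.ne',
      show α - 1 = -(1 - α) by ring, Real.rpow_neg hτ.le, Real.rpow_neg hτ.le]
    have h1 := Real.rpow_pos_of_pos hτ (1 - α)
    have h2 := Real.rpow_pos_of_pos hτ α
    field_simp
    ring
  have hkle : ∀ s ∈ Ioo 0 τ, (t - s) ^ (-α) ≤ (τ / t) ^ α * (τ - s) ^ (-α) := by
    intro s hs
    have hτs : 0 < τ - s := by linarith [hs.2]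
    have h1 : t / τ * (τ - s) ≤ t - s := by
      rw [div_mul_eq_mul_div, div_le_iff₀ hτ]
      nlinarith [hs.1]
    refine (Real.rpow_le_rpow_of_nonpos (by positivity) h1 (by linarith)).trans (le_of_eq ?_)
    rw [Real.mul_rpow (by positivity) hτs.le, Real.rpow_neg (by positivity),
      ← Real.inv_rpow (by positivity), inv_div]
  have hdv : IntervalIntegrable (deriv v) MeasureTheory.volume 0 τ := by
    have h := hpow.const_mul A
    rw [intervalIntegrable_iff_integrableOn_Ioo_of_le hτ.le] at h ⊢
    refine h.mono' (measurable_deriv v).aestronglyMeasurable ?_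
    filter_upwards [MeasureTheory.ae_restrict_mem measurableSet_Ioo] with s hs using hb s hs
  have hτt1 : (τ / t) ^ α ≤ 1 :=
    Real.rpow_le_one (by positivity) ((div_le_one ht).2 hτt) hα0.le
  have hkv : IntervalIntegrable (fun s => (t - s) ^ (-α) * deriv v s)
      MeasureTheory.volume 0 τ := by
    have h := hφint.const_mul A
    rw [intervalIntegrable_iff_integrableOn_Ioo_of_le hτ.le] at h ⊢
    refine h.mono' ((by fun_prop : Measurable fun s : ℝ => (t - s) ^ (-α)).mul
      (measurable_deriv v)).aestronglyMeasurable ?_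
    filter_upwards [MeasureTheory.ae_restrict_mem measurableSet_Ioo] with s hs
    have hs0 := hs.1
    have hτs : 0 < τ - s := by linarith [hs.2]
    have hts : 0 < t - s := by linarith
    rw [norm_mul, Real.norm_of_nonneg (by positivity)]
    calc (t - s) ^ (-α) * ‖deriv v s‖ ≤ 1 * (τ - s) ^ (-α) * (A * s ^ (α - 1)) := by
          refine mul_le_mul ((hkle s hs).trans ?_) (hb s hs) (norm_nonneg _) (by positivity)
          gcongr
      _ = A * ((τ - s) ^ (-α) * (0 + s ^ (α - 1))) := by ring
      _ ≤ A * ((τ - s) ^ (-α) * (1 / α * τ ^ (α - 1) + s ^ (α - 1))) := by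
          gcongr
          positivity
      _ ≤ A * φ s := mul_le_mul_of_nonneg_left (hφle s hs) hA
  refine ⟨hkv, ?_⟩
  have hslope : |(v τ - v 0) / (τ - 0)| ≤ A * (1 / α * τ ^ (α - 1)) := by
    have h1 : v τ - v 0 = ∫ s in (0 : ℝ)..τ, deriv v s :=
      (intervalIntegral.integral_eq_sub_of_hasDerivAt_of_le hτ.le hv
        (fun x hx => ((hd x hx).differentiableAt (isOpen_Ioo.mem_nhds hx)).hasDerivAt) hdv).symm
    have h2 : |v τ - v 0| ≤ A * (τ ^ α / α) := by
      rw [h1, ← Real.norm_eq_abs]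
      refine (intervalIntegral.norm_integral_le_of_norm_le hτ.le
        (g := fun s => A * s ^ (α - 1)) ?_ (hpow.const_mul A)).trans (le_of_eq ?_)
      · filter_upwards [MeasureTheory.Measure.ae_ne _ τ] with s hsb hs
        exact hb s ⟨hs.1, lt_of_le_of_ne hs.2 hsb⟩
      · rw [intervalIntegral.integral_const_mul, integral_rpow (Or.inl (by linarith)),
          show α - 1 + 1 = α by ring, Real.zero_rpow hα0.ne', sub_zero]
    rw [sub_zero, abs_div, abs_of_pos hτ, div_le_iff₀ hτ]
    refine h2.trans (le_of_eq ?_)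
    rw [Real.rpow_sub hτ, Real.rpow_one]
    field_simp
  rw [slope_mul_integral_sub_eq hα1 t hτ hv hd hdv hkv, ← Real.norm_eq_abs]
  refine (intervalIntegral.norm_integral_le_of_norm_le hτ.le
    (g := fun s => A * (τ / t) ^ (1 + α) * φ s) ?_ (hφint.const_mul _)).trans (le_of_eq ?_)
  · filter_upwards [MeasureTheory.Measure.ae_ne _ τ] with s hsb hs
    have hs' : s ∈ Ioo 0 τ := ⟨hs.1, lt_of_le_of_ne hs.2 hsb⟩
    have hs0 := hs'.1
    have hτs : 0 < τ - s := by linarith [hs'.2]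
    have hts : 0 < t - s := by linarith
    have h1 : ‖(v τ - v 0) / (τ - 0) - deriv v s‖ ≤
        A * (1 / α * τ ^ (α - 1) + s ^ (α - 1)) := by
      rw [mul_add]
      exact (norm_sub_le _ _).trans (add_le_add hslope (hb s hs'))
    have h2 : ‖(t - s) ^ (-α) - (t - 0) ^ (-α)‖ ≤ (τ / t) ^ (1 + α) * (τ - s) ^ (-α) := by
      rw [Real.norm_of_nonneg (sub_nonneg.2 (kernel_le_kernel hα0.le hs0.le (by linarith)))]
      calc _ ≤ (s - 0) / (t - 0) * (t - s) ^ (-α) :=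
            kernel_sub_kernel_le hα1.le hs0.le (by linarith)
        _ ≤ τ / t * ((τ / t) ^ α * (τ - s) ^ (-α)) := by
            rw [sub_zero, sub_zero]
            refine mul_le_mul ?_ (hkle s hs') (by positivity) (by positivity)
            gcongr
            exact hs.2
        _ = _ := by rw [Real.rpow_add (by positivity), Real.rpow_one]; ring
    rw [norm_mul]
    calc _ ≤ (τ / t) ^ (1 + α) * (τ - s) ^ (-α) *
          (A * (1 / α * τ ^ (α - 1) + s ^ (α - 1))) :=
          mul_le_mul h2 h1 (norm_nonneg _) (by positivity)
      _ = A * (τ / t) ^ (1 + α) *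
          ((τ - s) ^ (-α) * (1 / α * τ ^ (α - 1) + s ^ (α - 1))) := by ring
      _ ≤ _ := mul_le_mul_of_nonneg_left (hφle s hs') (by positivity)
  · rw [intervalIntegral.integral_const_mul, hφval]
    ring

/-- The regularity used of the exact solution, in terms of two-sided derivatives in the open
interval. -/
structure HasWeakSingularity (α A T : ℝ) (u : ℝ → ℝ) : Prop where
  cont : ContinuousOn u (Icc 0 T)
  diff : DifferentiableOn ℝ u (Ioo 0 T)
  bound : ∀ x ∈ Ioo 0 T, |deriv u x| ≤ A * x ^ (α - 1)
  diff₂ : DifferentiableOn ℝ (deriv u) (Ioo 0 T)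
  bound₂ : ∀ x ∈ Ioo 0 T, |deriv (deriv u) x| ≤ A * x ^ (α - 2)

/-- The truncation error of the L1 operator is at most of order `(t 1 / t m) ^ p` for every
`p ≤ (2 - α) / r` below `1 + α`. -/
theorem exists_truncation_bound {α θ p C A : ℝ} (hα0 : 0 < α) (hα1 : α < 1)
    (hθ0 : 0 ≤ θ) (hθ : θ ≤ 1) (hp : p ≤ (2 - α) * θ) (hpα : p < 1 + α) (hC : 1 ≤ C)
    (hA : 0 ≤ A) :
    ∃ D, 0 ≤ D ∧ ∀ (T : ℝ) (N : ℕ) (t : ℕ → ℝ) (u : ℝ → ℝ), IsMesh T N t →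
      HasGradedSteps θ C N t → HasWeakSingularity α A T u → ∀ m, 1 ≤ m → m ≤ N →
        |l1Sum α t (fun j => u (t j)) m -
          ∫ s in (0 : ℝ)..t m, (t m - s) ^ (-α) * deriv u s| ≤ D * (t 1 / t m) ^ p := by
  have h1α : 0 < 1 - α := by linarith
  have hαp : 0 < 1 + α - p := by linarith
  set D₁ := A * ((1 / α + 2 ^ (1 - α)) / (1 - α) + 2 ^ α / α) with hD₁
  set D₂ := A * (C ^ (2 - α) * C ^ 2 * 2 ^ (α + 1) + C ^ (2 - α) * 2 ^ (2 - α)) with hD₂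
  set D₃ := 1 / (1 + α - p) + C ^ (2 - α) * (1 / (1 - α) + 1 / α) with hD₃
  have hD₂0 : 0 ≤ D₂ := by positivity
  refine ⟨D₁ + D₂ * D₃, by positivity, fun T N t u ht hg hu m hm hmN => ?_⟩
  set τ := t 1 with hτdef
  have hτ : 0 < τ := ht.pos le_rfl (by omega)
  have htm : 0 < t m := ht.pos hm hmN
  have hτm : τ ≤ t m := ht.le hm hmN
  have hmT : t m ≤ T := by rw [← ht.last]; exact ht.le hmN le_rfl
  have hx0 : 0 < τ / t m := by positivity
  have hx1 : τ / t m ≤ 1 := (div_le_one htm).2 hτm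
  -- each interval separately
  obtain ⟨hI, hE⟩ := abs_slope_mul_integral_sub_le_of_first hα0 hα1 hτ hτm hA
    (hu.cont.mono (Icc_subset_Icc_right (hτm.trans hmT)))
    (hu.diff.mono (Ioo_subset_Ioo_right (hτm.trans hmT)))
    (fun x hx => hu.bound x ⟨hx.1, hx.2.trans_le (hτm.trans hmT)⟩)
  have hrest : ∀ j, 1 ≤ j → j < m →
      IntervalIntegrable (fun s => (t m - s) ^ (-α) * deriv u s) MeasureTheory.volume
        (t j) (t (j + 1)) ∧
      |(u (t (j + 1)) - u (t j)) / (t (j + 1) - t j) *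
          (∫ s in t j..t (j + 1), (t m - s) ^ (-α)) -
          ∫ s in t j..t (j + 1), (t m - s) ^ (-α) * deriv u s| ≤
        D₂ * ∫ s in t j..t (j + 1), majorant α θ (2 - α) p C τ (t m) s := by
    intro j hj hjm
    have hj0 : 0 < t j := ht.pos hj (by omega)
    have hjT : t (j + 1) ≤ T := (ht.le hjm hmN).trans hmT
    have hsub : Ioo (t j) (t (j + 1)) ⊆ Ioo 0 T := Ioo_subset_Ioo hj0.le hjT
    refine abs_slope_mul_integral_sub_le_majorant (v₂ := deriv (deriv u)) hα0 hα1 hθ (by linarith)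
      (hp.trans (by nlinarith)) hC hτ (ht.le hj (by omega)) (ht.lt_succ j (by omega))
      (ht.le hjm hmN) (hg.ratio j hj (by omega)) (hg.step j hj (by omega)) hA
      (hu.cont.mono (Icc_subset_Icc hj0.le hjT)) (hu.diff.mono hsub)
      (fun x hx => ((hu.diff₂ x (hsub hx)).differentiableAt
        (isOpen_Ioo.mem_nhds (hsub hx))).hasDerivAt) fun x hx => ?_
    refine (hu.bound₂ x (hsub hx)).trans (mul_le_mul_of_nonneg_left ?_ hA)
    rw [show -(2 - α) = α - 2 by ring]
    exact Real.rpow_le_rpow_of_nonpos hj0 hx.1.le (by linarith)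
  -- summation, by induction on the last interval
  have hsum : ∀ n, 1 ≤ n → n ≤ m →
      IntervalIntegrable (fun s => (t m - s) ^ (-α) * deriv u s) MeasureTheory.volume 0 (t n) ∧
      |(∑ j ∈ Finset.Icc 1 n, (u (t j) - u (t (j - 1))) / (t j - t (j - 1)) *
          ∫ s in t (j - 1)..t j, (t m - s) ^ (-α)) -
          ∫ s in (0 : ℝ)..t n, (t m - s) ^ (-α) * deriv u s| ≤
        D₁ * (τ / t m) ^ (1 + α) +
          D₂ * ∫ s in τ..t n, majorant α θ (2 - α) p C τ (t m) s := by
    intro n hn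
    induction n, hn using Nat.le_induction with
    | base =>
      intro _
      refine ⟨hI, ?_⟩
      rw [Finset.Icc_self, Finset.sum_singleton, Nat.sub_self, ht.zero, ← hτdef,
        intervalIntegral.integral_same, mul_zero, add_zero]
      exact hE
    | succ n hn ih =>
      intro hnm
      obtain ⟨h1, h2⟩ := ih (by omega)
      obtain ⟨h3, h4⟩ := hrest n hn (by omega)
      refine ⟨h1.trans h3, ?_⟩
      have hτn : τ ≤ t n := ht.le hn (by omega)
      rw [Finset.sum_Icc_succ_top (by omega), Nat.add_sub_cancel,
        ← intervalIntegral.integral_add_adjacent_intervals h1 h3,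
        ← intervalIntegral.integral_add_adjacent_intervals (a := τ) (b := t n)
          (intervalIntegrable_majorant hα1 (by linarith) hτ hτ hτn (ht.le (by omega) hmN))
          (intervalIntegrable_majorant hα1 (by linarith) hτ (hτ.trans_le hτn)
            (ht.lt_succ n (by omega)).le (ht.le hnm hmN)), add_sub_add_comm]
      refine (abs_add_le _ _).trans ((add_le_add h2 h4).trans (le_of_eq (by ring)))
  have hmaj := integral_majorant_le (θ := θ) (μ := 2 - α) (e := p) (C := C) hα0 hα1
    (by linarith) hτ hτ hτm
  have hfar : ∫ s in τ..t m, s ^ (2 - (2 - α) - p) ≤ (t m) ^ (1 + α - p) / (1 + α - p) := by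
    rw [integral_rpow (Or.inl (by linarith)), show 2 - (2 - α) - p + 1 = 1 + α - p by ring]
    have := Real.rpow_nonneg hτ.le (1 + α - p)
    gcongr
    linarith
  have hmaj' : ∫ s in τ..t m, majorant α θ (2 - α) p C τ (t m) s ≤ D₃ * (τ / t m) ^ p := by
    refine hmaj.trans ?_
    rw [hD₃, add_mul, sub_self, Real.rpow_zero, one_mul]
    refine add_le_add ?_ (mul_le_mul_of_nonneg_left
      (Real.rpow_le_rpow_of_exponent_ge hx0 hx1 hp) (by positivity))
    calc _ ≤ t m ^ (-α - 1) * (τ ^ p * ((t m) ^ (1 + α - p) / (1 + α - p))) := by gcongr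
      _ = _ := by
        have h1 : t m ^ (-α - 1) * t m ^ (1 + α - p) = (t m ^ p)⁻¹ := by
          rw [← Real.rpow_add htm, ← Real.rpow_neg htm.le]
          congr 1; ring
        rw [Real.div_rpow hτ.le htm.le, div_eq_mul_inv (τ ^ p), ← h1]
        ring
  refine (hsum m hm le_rfl).2.trans ?_
  rw [add_mul, mul_assoc D₂]
  exact add_le_add (mul_le_mul_of_nonneg_left
    (Real.rpow_le_rpow_of_exponent_ge hx0 hx1 hpα.le) (by positivity))
    (mul_le_mul_of_nonneg_left hmaj' hD₂0)

/-! ### Barrier functions -/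

/-- The barrier with parameter `σ`: linear on `[0, σ]` and equal to `s ^ (α - 1)` beyond. The power
`s ^ (α - 1)` is annihilated by the Riemann–Liouville derivative of order `α`; it describes the decay
of solutions whose data are concentrated near `0`. -/
noncomputable def barrier (α σ s : ℝ) : ℝ :=
  if s ≤ σ then σ ^ (α - 2) * s else s ^ (α - 1)

theorem barrier_of_le {α σ s : ℝ} (h : s ≤ σ) : barrier α σ s = σ ^ (α - 2) * s := if_pos h

theorem barrier_of_ge {α σ s : ℝ} (hσ : 0 < σ) (h : σ ≤ s) : barrier α σ s = s ^ (α - 1) := by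
  rcases h.eq_or_lt with rfl | h
  · rw [barrier_of_le le_rfl, show α - 1 = α - 2 + 1 by ring, Real.rpow_add hσ, Real.rpow_one]
  · exact if_neg (not_le.2 h)

theorem barrier_zero {α σ : ℝ} (hσ : 0 < σ) : barrier α σ 0 = 0 := by
  rw [barrier_of_le hσ.le, mul_zero]

theorem barrier_le {α σ s : ℝ} (hα1 : α < 1) (hs : 0 < s) : barrier α σ s ≤ s ^ (α - 1) := by
  unfold barrier
  split_ifs with h
  · have : σ ^ (α - 2) ≤ s ^ (α - 2) := Real.rpow_le_rpow_of_nonpos hs h (by linarith)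
    rw [show α - 1 = α - 2 + 1 by ring, Real.rpow_add hs, Real.rpow_one]
    gcongr
  · exact le_rfl

/-- The part of the fractional derivative of `s ^ (α - 1)` that stems from an interval `[a, b]`. -/
theorem integral_kernel_mul_deriv_rpow {α a b t : ℝ} (hα1 : α < 1) (ha : 0 < a)
    (hab : a ≤ b) (hbt : b ≤ t)
    (hint : IntervalIntegrable (fun s => (t - s) ^ (-α) * deriv (fun x : ℝ => x ^ (α - 1)) s)
      MeasureTheory.volume a b) :
    ∫ s in a..b, (t - s) ^ (-α) * deriv (fun x : ℝ => x ^ (α - 1)) s =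
      ((t - b) / b) ^ (1 - α) / t - ((t - a) / a) ^ (1 - α) / t := by
  have ht : 0 < t := by linarith
  refine intervalIntegral.integral_eq_sub_of_hasDerivAt_of_le
    (f := fun s => ((t - s) / s) ^ (1 - α) / t) hab ?_ ?_ hint
  · refine ContinuousOn.div_const (ContinuousOn.rpow_const ?_ fun _ _ => Or.inr (by linarith)) _
    exact (by fun_prop : ContinuousOn (fun s : ℝ => t - s) _).div continuousOn_id
      fun s hs => (ha.trans_le hs.1).ne'
  · intro s hs
    have hs0 : 0 < s := ha.trans hs.1
    have hts : 0 < t - s := by linarith [hs.2]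
    have h1 : HasDerivAt (fun s : ℝ => (t - s) / s) ((-1 * s - (t - s) * 1) / s ^ 2) s :=
      ((hasDerivAt_id s).const_sub t).div (hasDerivAt_id s) hs0.ne'
    have h2 := (h1.rpow_const (p := 1 - α) (Or.inl (by positivity))).div_const t
    rw [(Real.hasDerivAt_rpow_const (p := α - 1) (Or.inl hs0.ne')).deriv]
    refine h2.congr_deriv (Eq.symm ?_)
    rw [show 1 - α - 1 = -α by ring, Real.div_rpow hts.le hs0.le, Real.rpow_neg hs0.le,
      show α - 1 - 1 = α - (2 : ℕ) by push_cast; ring, Real.rpow_sub_natCast hs0.ne']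
    field_simp
    ring

/-- On an interval of the graded mesh, the interpolant of the convex function `s ^ (α - 1)` loses
no more than the integral of a majorant. -/
theorem le_slope_rpow_mul_integral {α θ e C τ t a b : ℝ} (hα0 : 0 < α) (hα1 : α < 1)
    (hθ : θ ≤ 1) (he : e ≤ 2 * θ) (hC : 1 ≤ C) (hτ : 0 < τ) (hτa : τ ≤ a) (hab : a < b)
    (hbt : b ≤ t) (hratio : b ≤ C * a) (hstep : b - a ≤ C * (a * (τ / a) ^ θ)) :
    ((t - b) / b) ^ (1 - α) / t - ((t - a) / a) ^ (1 - α) / t -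
        2 * (C ^ (3 - α) * C ^ 2 * 2 ^ (α + 1) + C ^ (3 - α) * 2 ^ (3 - α)) *
          (∫ s in a..b, majorant α θ (3 - α) e C τ t s) ≤
      (b ^ (α - 1) - a ^ (α - 1)) / (b - a) * ∫ s in a..b, (t - s) ^ (-α) := by
  have ha : 0 < a := hτ.trans_le hτa
  have hder : ∀ x : ℝ, 0 < x → HasDerivAt (fun x : ℝ => x ^ (α - 1)) ((α - 1) * x ^ (α - 2)) x := by
    intro x hx
    have := Real.hasDerivAt_rpow_const (p := α - 1) (Or.inl hx.ne')
    rwa [show α - 1 - 1 = α - 2 by ring] at this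
  obtain ⟨h1, h2⟩ := abs_slope_mul_integral_sub_le_majorant (A := 2) (μ := 3 - α)
    (v := fun x : ℝ => x ^ (α - 1)) (v₂ := fun x => (α - 1) * ((α - 2) * x ^ (α - 3)))
    hα0 hα1 hθ (by linarith) he hC hτ hτa hab hbt hratio hstep (by norm_num)
    (fun x hx => (hder x (ha.trans_le hx.1)).continuousAt.continuousWithinAt)
    (fun x hx => (hder x (ha.trans hx.1)).differentiableAt.differentiableWithinAt)
    (fun x hx => by
      have hx0 : 0 < x := ha.trans hx.1
      have h3 := (Real.hasDerivAt_rpow_const (p := α - 2) (Or.inl hx0.ne')).const_mul (α - 1)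
      rw [show α - 2 - 1 = α - 3 by ring] at h3
      refine h3.congr_of_eventuallyEq ?_
      filter_upwards [isOpen_Ioi.mem_nhds hx0] with y hy using (hder y hy).deriv)
    (fun x hx => by
      have hx0 : 0 < x := ha.trans hx.1
      have h3 : x ^ (α - 3) ≤ a ^ (α - 3) :=
        Real.rpow_le_rpow_of_nonpos ha hx.1.le (by linarith)
      rw [abs_mul, abs_mul, abs_of_neg (by linarith), abs_of_neg (by linarith : α - 2 < 0),
        abs_of_pos (by positivity), show -(3 - α) = α - 3 by ring, ← mul_assoc]
      exact mul_le_mul (by nlinarith) h3 (by positivity) (by norm_num))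
  rw [integral_kernel_mul_deriv_rpow hα1 ha hab.le hbt h1] at h2
  linarith [(abs_le.1 h2).1]

/-- Inserting a node at a concave kink does not increase the L1 operator. -/
theorem add_le_slope_mul_integral {α t a σ b A S B : ℝ} (hα0 : 0 ≤ α) (hα1 : α < 1)
    (haσ : a < σ) (hσb : σ < b) (hbt : b ≤ t) (hAS : A ≤ S) (hSB : B ≤ S) :
    (S - A) / (σ - a) * (∫ s in a..σ, (t - s) ^ (-α)) +
        (B - S) / (b - σ) * (∫ s in σ..b, (t - s) ^ (-α)) ≤
      (B - A) / (b - a) * ∫ s in a..b, (t - s) ^ (-α) := by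
  rw [← intervalIntegral.integral_add_adjacent_intervals (intervalIntegrable_kernel hα1 t a σ)
    (intervalIntegrable_kernel hα1 t σ b)]
  have h1 := integral_kernel_le_sub_mul hα0 hα1 haσ.le (hσb.trans_le hbt)
  have h2 := sub_mul_kernel_le_integral hα0 hα1 hσb.le hbt
  set I := ∫ s in a..σ, (t - s) ^ (-α)
  set J := ∫ s in σ..b, (t - s) ^ (-α)
  set k := (t - σ) ^ (-α)
  have hx : 0 < σ - a := by linarith
  have hy : 0 < b - σ := by linarith
  have h3 : (B - A) / (b - a) * (I + J) -
      ((S - A) / (σ - a) * I + (B - S) / (b - σ) * J) =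
      (J * (σ - a) - I * (b - σ)) / (b - a) * ((S - A) / (σ - a) + (S - B) / (b - σ)) := by
    have hz : b - a ≠ 0 := by linarith
    field_simp
    ring
  have h4 : 0 ≤ J * (σ - a) - I * (b - σ) := by nlinarith
  have h5 : 0 ≤ (J * (σ - a) - I * (b - σ)) / (b - a) * ((S - A) / (σ - a) + (S - B) / (b - σ)) :=
    mul_nonneg (div_nonneg h4 (by linarith)) (add_nonneg (div_nonneg (by linarith) hx.le)
      (div_nonneg (by linarith) hy.le))
  linarith

/-- Up to the kink the barrier is linear, and the L1 operator is exact. -/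
theorem l1Sum_barrier_of_le {α σ T : ℝ} {N : ℕ} {t : ℕ → ℝ} (hα1 : α < 1)
    (ht : IsMesh T N t) {m : ℕ} (hm : m ≤ N) (hmσ : t m ≤ σ) :
    l1Sum α t (fun j => barrier α σ (t j)) m =
      σ ^ (α - 2) * ((t m) ^ (1 - α) / (1 - α)) := by
  have h : ∀ n, n ≤ m → ∑ j ∈ Finset.Icc 1 n,
      (barrier α σ (t j) - barrier α σ (t (j - 1))) / (t j - t (j - 1)) *
        ∫ s in t (j - 1)..t j, (t m - s) ^ (-α) =
      σ ^ (α - 2) * ∫ s in (0 : ℝ)..t n, (t m - s) ^ (-α) := by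
    intro n
    induction n with
    | zero => simp [ht.zero]
    | succ n ih =>
      intro hn
      have hlt := ht.lt_succ n (by omega)
      have hle : t (n + 1) ≤ σ := (ht.le hn hm).trans hmσ
      have hI := intervalIntegral.integral_add_adjacent_intervals
        (intervalIntegrable_kernel hα1 (t m) 0 (t n))
        (intervalIntegrable_kernel hα1 (t m) (t n) (t (n + 1)))
      rw [Finset.sum_Icc_succ_top (by omega), ih (by omega), Nat.add_sub_cancel, ← hI,
        barrier_of_le hle, barrier_of_le (hlt.le.trans hle), ← mul_sub,
        mul_div_cancel_right₀ _ (sub_pos.2 hlt).ne', mul_add]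
  unfold l1Sum
  rw [h m le_rfl, integral_kernel hα1, sub_zero, sub_self, Real.zero_rpow (by linarith), sub_zero]

/-- The fractional derivative of the barrier beyond its kink, up to the factor `Γ(1-α)⁻¹`, is
bounded below by a multiple of `σ ^ α * t ^ (-α - 1)`. -/
theorem le_caputo_barrier {α σ t : ℝ} (hα0 : 0 < α) (hα1 : α < 1) (hσ : 0 < σ) (hσt : σ < t) :
    (1 - α) * (t ^ (-α - 1) * σ ^ α) ≤
      σ ^ (α - 2) * ((t ^ (1 - α) - (t - σ) ^ (1 - α)) / (1 - α)) -
        ((t - σ) / σ) ^ (1 - α) / t := by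
  have ht : 0 < t := hσ.trans hσt
  have h1α : 0 < 1 - α := by linarith
  set x := σ / t with hx
  have hx0 : 0 < x := by positivity
  have hx1 : x < 1 := (div_lt_one ht).2 hσt
  have hσx : σ = t * x := by rw [hx]; field_simp
  set y := (1 - x) ^ (1 - α) with hy
  have hy1 : y ≤ 1 - (1 - α) * x := by
    have := rpow_one_add_le_one_add_mul_self (s := -x) (p := 1 - α) (by linarith) h1α.le
      (by linarith)
    rw [← sub_eq_add_neg] at this
    linarith
  have e1 : (t - σ) ^ (1 - α) = t ^ (1 - α) * y := by
    rw [hσx, hy, ← Real.mul_rpow ht.le (by linarith)]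
    congr 1; ring
  have e2 : ((t - σ) / σ) ^ (1 - α) / t = σ ^ (α - 2) * t ^ (1 - α) * (x * y) := by
    have a1 : σ ^ (α - 2) = (σ ^ (1 - α))⁻¹ / σ := by
      rw [← Real.rpow_neg hσ.le, ← Real.rpow_sub_one hσ.ne']; congr 1; ring
    rw [Real.div_rpow (by linarith) hσ.le, e1, a1, hx]
    field_simp
  have e3 : t ^ (-α - 1) * σ ^ α = σ ^ (α - 2) * t ^ (1 - α) * x ^ 2 := by
    have a1 : σ ^ α = σ ^ (α - 2) * σ ^ 2 := by
      rw [← Real.rpow_natCast σ 2, ← Real.rpow_add hσ]; congr 1; push_cast; ring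
    have a2 : t ^ (1 - α) = t ^ (-α - 1) * t ^ 2 := by
      rw [← Real.rpow_natCast t 2, ← Real.rpow_add ht]; congr 1; push_cast; ring
    rw [a1, a2, hx]
    field_simp
  rw [e1, e2, e3]
  have hP : 0 < σ ^ (α - 2) * t ^ (1 - α) := by positivity
  have h1 : (1 - α) * x ^ 2 ≤ (1 - y) / (1 - α) - x * y := by
    have h2 : x ≤ (1 - y) / (1 - α) := by
      rw [le_div_iff₀ h1α]; linarith
    nlinarith
  calc _ = σ ^ (α - 2) * t ^ (1 - α) * ((1 - α) * x ^ 2) := by ring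
    _ ≤ σ ^ (α - 2) * t ^ (1 - α) * ((1 - y) / (1 - α) - x * y) := by gcongr
    _ = _ := by ring

/-- If the kink is far enough from the first node, relative to `t 1`, then the truncation error of
the barrier is dominated by its fractional derivative. -/
theorem exists_l1Sum_barrier_nonneg {α θ C : ℝ} (hα0 : 0 < α) (hα1 : α < 1)
    (hθ0 : 0 ≤ θ) (hθ : θ ≤ 1) (hq : α < (2 - α) * θ) (hC : 1 ≤ C) :
    ∃ Λ : ℝ, 1 ≤ Λ ∧ ∀ (T : ℝ) (N : ℕ) (t : ℕ → ℝ) (σ : ℝ), IsMesh T N t →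
      HasGradedSteps θ C N t → Λ * t 1 ≤ σ → ∀ m, 1 ≤ m → m ≤ N →
        0 ≤ l1Sum α t (fun j => barrier α σ (t j)) m := by
  have h1α : 0 < 1 - α := by linarith
  set q := (2 - α) * θ with hqdef
  have hq0 : 0 < q := by linarith
  have hqα : 0 < q - α := by linarith
  set D := 2 * (C ^ (3 - α) * C ^ 2 * 2 ^ (α + 1) + C ^ (3 - α) * 2 ^ (3 - α)) with hD
  set E := 1 / (q - α) + C ^ (2 - α) * (1 / (1 - α) + 1 / α) with hE
  have hD0 : 0 < D := by positivity
  have hE0 : 0 < E := by positivity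
  refine ⟨max 1 ((D * E / (1 - α)) ^ (1 / q)), le_max_left _ _,
    fun T N t σ ht hg hσΛ m hm hmN => ?_⟩
  set Λ := max 1 ((D * E / (1 - α)) ^ (1 / q)) with hΛ
  have hΛ1 : 1 ≤ Λ := le_max_left _ _
  set τ := t 1 with hτdef
  have hτ : 0 < τ := ht.pos le_rfl (by omega)
  have htm : 0 < t m := ht.pos hm hmN
  have hτσ : τ ≤ σ := by nlinarith
  have hσ : 0 < σ := hτ.trans_le hτσ
  rcases le_or_gt (t m) σ with hmσ | hmσ
  · rw [l1Sum_barrier_of_le hα1 ht hmN hmσ]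
    positivity
  have hsmall : D * E * (τ / σ) ^ q ≤ 1 - α := by
    have h1 : D * E / (1 - α) ≤ Λ ^ q := by
      calc D * E / (1 - α) = ((D * E / (1 - α)) ^ (1 / q)) ^ q := by
            rw [← Real.rpow_mul (by positivity), one_div_mul_cancel hq0.ne', Real.rpow_one]
        _ ≤ Λ ^ q := by
            gcongr
            exact le_max_right _ _
    have h2 : Λ ^ q * (τ / σ) ^ q ≤ 1 := by
      rw [← Real.mul_rpow (by linarith) (by positivity)]
      refine Real.rpow_le_one (by positivity) ?_ hq0.le
      rw [← mul_div_assoc]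
      exact (div_le_one hσ).2 hσΛ
    rw [div_le_iff₀ h1α] at h1
    have h3 : 0 ≤ (τ / σ) ^ q := by positivity
    nlinarith
  -- partial sums up to a node `x` stay above `Ψ x`
  set M : ℝ → ℝ := majorant α θ (3 - α) q C τ (t m) with hM
  have hMint : ∀ a b, 0 < a → a ≤ b → b ≤ t m →
      IntervalIntegrable M MeasureTheory.volume a b := fun a b h1 h2 h3 =>
    intervalIntegrable_majorant hα1 (by linarith) hτ h1 h2 h3
  set P : ℝ → ℝ := fun x => ((t m - x) / x) ^ (1 - α) / t m with hP
  set Ψ : ℝ → ℝ := fun x => if x ≤ σ then σ ^ (α - 2) * ∫ s in (0 : ℝ)..x, (t m - s) ^ (-α)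
    else (σ ^ (α - 2) * ∫ s in (0 : ℝ)..σ, (t m - s) ^ (-α)) + (P x - P σ) -
      D * ∫ s in σ..x, M s with hΨ
  have hΨ₁ : ∀ x, x ≤ σ → Ψ x = σ ^ (α - 2) * ∫ s in (0 : ℝ)..x, (t m - s) ^ (-α) :=
    fun x hx => if_pos hx
  have hΨ₂ : ∀ x, σ ≤ x → Ψ x = (σ ^ (α - 2) * ∫ s in (0 : ℝ)..σ, (t m - s) ^ (-α)) +
      (P x - P σ) - D * ∫ s in σ..x, M s := by
    intro x hx
    rcases hx.eq_or_lt with rfl | hx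
    · rw [hΨ₁ σ le_rfl, intervalIntegral.integral_same]; ring
    · exact if_neg (not_le.2 hx)
  have hlin : ∀ a b, a < b → b ≤ σ → Ψ b - Ψ a =
      (barrier α σ b - barrier α σ a) / (b - a) * ∫ s in a..b, (t m - s) ^ (-α) := by
    intro a b hab hb
    rw [hΨ₁ b hb, hΨ₁ a (hab.le.trans hb), barrier_of_le hb, barrier_of_le (hab.le.trans hb),
      ← mul_sub, ← mul_sub, mul_div_cancel_right₀ _ (sub_pos.2 hab).ne',
      intervalIntegral.integral_interval_sub_left (intervalIntegrable_kernel hα1 _ _ _)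
        (intervalIntegrable_kernel hα1 _ _ _)]
  have htail : ∀ a b, σ ≤ a → a < b → b ≤ t m → b ≤ C * a → b - a ≤ C * (a * (τ / a) ^ θ) →
      Ψ b - Ψ a ≤
        (barrier α σ b - barrier α σ a) / (b - a) * ∫ s in a..b, (t m - s) ^ (-α) := by
    intro a b ha hab hbt h1 h2
    have h3 := le_slope_rpow_mul_integral (e := q) hα0 hα1 hθ
      (by rw [hqdef]; nlinarith) hC hτ (hτσ.trans ha) hab hbt h1 h2
    have h4 := intervalIntegral.integral_add_adjacent_intervals
      (hMint σ a hσ ha (hab.le.trans hbt)) (hMint a b (hσ.trans_le ha) hab.le hbt)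
    rw [hΨ₂ b (ha.trans hab.le), hΨ₂ a ha, barrier_of_ge hσ ha,
      barrier_of_ge hσ (ha.trans hab.le), ← h4]
    refine le_trans (le_of_eq ?_) h3
    ring
  have hpart : ∀ n, n ≤ m → Ψ (t n) ≤ ∑ j ∈ Finset.Icc 1 n,
      (barrier α σ (t j) - barrier α σ (t (j - 1))) / (t j - t (j - 1)) *
        ∫ s in t (j - 1)..t j, (t m - s) ^ (-α) := by
    intro n
    induction n with
    | zero =>
      intro _
      rw [ht.zero, hΨ₁ 0 hσ.le]
      simp
    | succ n ih =>
      intro hn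
      rw [Finset.sum_Icc_succ_top (by omega), Nat.add_sub_cancel]
      have hlt := ht.lt_succ n (by omega)
      have hbt : t (n + 1) ≤ t m := ht.le hn hmN
      refine le_trans ?_ (add_le_add (ih (by omega)) le_rfl)
      rw [← sub_le_iff_le_add']
      rcases le_or_gt (t (n + 1)) σ with hb | hb
      · exact (hlin _ _ hlt hb).le
      have hn1 : 1 ≤ n := by
        by_contra hn0
        obtain rfl : n = 0 := by omega
        exact absurd hb (not_lt.2 hτσ)
      have hr := hg.ratio n hn1 (by omega)
      have hs := hg.step n hn1 (by omega)
      rcases le_or_gt σ (t n) with ha | ha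
      · exact htail _ _ ha hlt hbt hr hs
      · have htn : 0 < t n := ht.pos hn1 (by omega)
        refine le_trans ?_ (add_le_slope_mul_integral hα0.le hα1 ha hb hbt
          (S := barrier α σ σ) ?_ ?_)
        · rw [← hlin _ _ ha le_rfl]
          have := htail σ (t (n + 1)) le_rfl hb hbt (hr.trans (by gcongr))
            ((sub_le_sub_left ha.le _).trans (hs.trans (mul_le_mul_of_nonneg_left
              (mul_div_rpow_le hθ hτ htn ha.le) (by linarith))))
          linarith
        · rw [barrier_of_le ha.le, barrier_of_le le_rfl]
          gcongr
        · rw [barrier_of_ge hσ hb.le, barrier_of_ge hσ le_rfl]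
          exact Real.rpow_le_rpow_of_nonpos hσ hb.le (by linarith)
  refine le_trans ?_ (hpart m le_rfl)
  have hPm : P (t m) = 0 := by
    rw [hP]
    simp only
    rw [sub_self, zero_div, Real.zero_rpow h1α.ne', zero_div]
  have hmaj := integral_majorant_le (θ := θ) (μ := 3 - α) (e := q) (C := C) hα0 hα1
    (by linarith) hτ hσ hmσ.le
  have hfar : ∫ s in σ..t m, s ^ (2 - (3 - α) - q) ≤ σ ^ (α - q) / (q - α) := by
    rw [integral_rpow (Or.inr ⟨by linarith, ?_⟩), show 2 - (3 - α) - q + 1 = -(q - α) by ring,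
      div_neg, ← neg_div, neg_sub, neg_sub]
    · have := Real.rpow_nonneg htm.le (α - q)
      gcongr
      linarith
    · rw [uIcc_of_le hmσ.le]
      exact fun h0 => absurd h0.1 (by linarith)
  have hmaj' : ∫ s in σ..t m, M s ≤ E * ((t m) ^ (-α - 1) * σ ^ α * (τ / σ) ^ q) := by
    have e1 : σ ^ α * (τ / σ) ^ q = τ ^ q * σ ^ (α - q) := by
      rw [Real.div_rpow hτ.le hσ.le, Real.rpow_sub hσ]; ring
    refine hmaj.trans ?_
    rw [hE, add_mul, mul_assoc (t m ^ (-α - 1)), e1]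
    refine add_le_add ?_ (mul_le_mul_of_nonneg_left ?_ (by positivity))
    · calc _ ≤ t m ^ (-α - 1) * (τ ^ q * (σ ^ (α - q) / (q - α))) := by gcongr
        _ = _ := by ring
    · have e2 : t m ^ (2 - α - (3 - α)) * (τ / t m) ^ q =
          t m ^ (-α - 1) * (τ ^ q * t m ^ (α - q)) := by
        rw [Real.div_rpow hτ.le htm.le, show 2 - α - (3 - α) = (-α - 1) + (α - q) + q by ring,
          Real.rpow_add htm, Real.rpow_add htm]
        have := Real.rpow_pos_of_pos htm q
        field_simp
      rw [← hqdef, e2]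
      have := Real.rpow_le_rpow_of_nonpos hσ hmσ.le (by linarith : α - q ≤ 0)
      gcongr
  have hcap := le_caputo_barrier hα0 hα1 hσ hmσ
  rw [hΨ₂ _ hmσ.le, integral_kernel hα1, sub_zero, hPm]
  have h5 : D * ∫ s in σ..t m, M s ≤ (1 - α) * (t m ^ (-α - 1) * σ ^ α) := by
    calc D * ∫ s in σ..t m, M s ≤ D * (E * ((t m) ^ (-α - 1) * σ ^ α * (τ / σ) ^ q)) := by gcongr
      _ = D * E * (τ / σ) ^ q * (t m ^ (-α - 1) * σ ^ α) := by ring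
      _ ≤ _ := by gcongr
  have h6 : P σ = ((t m - σ) / σ) ^ (1 - α) / t m := rfl
  rw [h6]
  linarith

/-! ### Stability -/

theorem kernel_mul_le_l1Sum {α T : ℝ} {N : ℕ} {t : ℕ → ℝ} (hα0 : 0 ≤ α) (hα1 : α < 1)
    (ht : IsMesh T N t) {W : ℕ → ℝ} (h0 : W 0 = 0) {m : ℕ} (hm : m ≤ N)
    (hW : ∀ j < m, W j ≤ W (j + 1)) : t m ^ (-α) * W m ≤ l1Sum α t W m := by
  have h : ∀ n, n ≤ m → t m ^ (-α) * W n ≤ ∑ j ∈ Finset.Icc 1 n,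
      (W j - W (j - 1)) / (t j - t (j - 1)) * ∫ s in t (j - 1)..t j, (t m - s) ^ (-α) := by
    intro n
    induction n with
    | zero => simp [h0]
    | succ n ih =>
      intro hn
      rw [Finset.sum_Icc_succ_top (by omega), Nat.add_sub_cancel]
      have hlt := sub_pos.2 (ht.lt_succ n (by omega))
      have htn : 0 ≤ t n := by simpa [ht.zero] using ht.le (Nat.zero_le n) (by omega)
      have htm : t (n + 1) ≤ t m := ht.le hn hm
      have h1 := sub_mul_kernel_le_integral hα0 hα1 (sub_pos.1 hlt).le htm
      have h2 : t m ^ (-α) ≤ (t m - t n) ^ (-α) := by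
        simpa using kernel_le_kernel hα0 htn (by linarith : t n < t m)
      have h3 : (W (n + 1) - W n) * t m ^ (-α) ≤ (W (n + 1) - W n) / (t (n + 1) - t n) *
          ∫ s in t n..t (n + 1), (t m - s) ^ (-α) := by
        rw [div_mul_eq_mul_div, le_div_iff₀ hlt, mul_assoc]
        refine mul_le_mul_of_nonneg_left ?_ (sub_nonneg.2 (hW n (by omega)))
        refine le_trans ?_ h1
        rw [mul_comm]
        gcongr
      linarith [ih (by omega)]
  exact h m le_rfl

/-- For `p ≤ α` the increasing grid function `t j ^ (α - p)` is a barrier. -/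
theorem abs_le_of_l1Sum_le_of_le {α p D T : ℝ} {N : ℕ} {t V : ℕ → ℝ} (hα0 : 0 ≤ α)
    (hα1 : α < 1) (hp : p ≤ α) (ht : IsMesh T N t) (hD : 0 ≤ D) (hV : V 0 = 0) {m : ℕ}
    (hm1 : 1 ≤ m) (hm : m ≤ N)
    (h : ∀ i, 1 ≤ i → i ≤ m → |l1Sum α t V i| ≤ D * (t 1 / t i) ^ p) :
    |V m| ≤ D * (t 1 ^ p * t m ^ (α - p)) := by
  have hτ : 0 < t 1 := ht.pos le_rfl (by omega)
  -- for `p = α` the value at `0` has to be set to zero by hand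
  set W : ℕ → ℝ := fun j => if j = 0 then 0 else D * (t 1 ^ p * t j ^ (α - p)) with hW
  have hWj : ∀ j, j ≠ 0 → W j = D * (t 1 ^ p * t j ^ (α - p)) := fun j hj => if_neg hj
  have key := abs_le_of_abs_l1Sum_le (W := W) hα0 hα1 ht hV (by simp [hW]) hm fun i hi him => by
    have hti : 0 < t i := ht.pos hi (by omega)
    refine (h i hi him).trans (le_trans (le_of_eq ?_)
      (kernel_mul_le_l1Sum hα0 hα1 ht (by simp [hW]) (him.trans hm) fun j hj => ?_))
    · rw [hWj i (by omega), Real.div_rpow hτ.le hti.le, Real.rpow_sub hti, Real.rpow_neg hti.le]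
      have := Real.rpow_pos_of_pos hti α
      field_simp
    · rw [hWj (j + 1) (by omega)]
      rcases Nat.eq_zero_or_pos j with rfl | hj0
      · have := (ht.pos (j := 0 + 1) (by omega) (by omega)).le
        simp only [hW, if_true]
        positivity
      · rw [hWj j (by omega)]
        have h1 := Real.rpow_le_rpow (ht.pos hj0 (by omega)).le
          (ht.lt_succ j (by omega)).le (by linarith : 0 ≤ α - p)
        gcongr
  rwa [hWj m (by omega)] at key

/-- For `α < (2 - α) / r` a dyadic sum of barriers, with kinks at the points `2 ^ k * Λ * t 1`,
dominates: at each node the one with the nearest kink on the right gives the required lower bound,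
the others contribute nonnegative amounts. -/
theorem exists_dyadic_stability_bound {α θ p C : ℝ} (hα0 : 0 < α) (hα1 : α < 1)
    (hθ0 : 0 ≤ θ) (hθ : θ ≤ 1) (hq : α < (2 - α) * θ) (hp : 0 ≤ p) (hC : 1 ≤ C) :
    ∃ S, 0 ≤ S ∧ ∀ (T : ℝ) (N : ℕ) (t V : ℕ → ℝ) (D : ℝ), IsMesh T N t →
      HasGradedSteps θ C N t → 0 ≤ D → V 0 = 0 → ∀ m n : ℕ, 1 ≤ m → m ≤ N →
        t m / t 1 < 2 ^ (n + 1) →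
        (∀ i, 1 ≤ i → i ≤ m → |l1Sum α t V i| ≤ D * (t 1 / t i) ^ p) →
        |V m| ≤ S * D * (t 1 * t m ^ (α - 1)) *
          ∑ k ∈ Finset.range (n + 2), ((2 : ℝ) ^ (1 - p)) ^ k := by
  obtain ⟨Λ, hΛ, hB⟩ := exists_l1Sum_barrier_nonneg (C := C) hα0 hα1 hθ0 hθ hq hC
  have hΛ0 : 0 < Λ := by linarith
  have h1α : 0 < 1 - α := by linarith
  set G := (1 - α) * (2 * Λ) ^ (p + (1 - α)) with hG
  have hG0 : 0 < G := by positivity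
  refine ⟨G * Λ ^ (1 - p), by positivity, fun T N t V D ht hg hD hV m n hm hmN hn h => ?_⟩
  set τ := t 1 with hτdef
  have hτ : 0 < τ := ht.pos le_rfl (by omega)
  have htm : 0 < t m := ht.pos hm hmN
  set σ : ℕ → ℝ := fun k => 2 ^ k * Λ * τ with hσ
  have hσ0 : ∀ k, 0 < σ k := fun k => by simp only [hσ]; positivity
  have hΛσ : ∀ k, Λ * τ ≤ σ k := fun k => by
    have : (1 : ℝ) ≤ 2 ^ k := one_le_pow₀ (by norm_num)
    simp only [hσ]
    rw [mul_assoc]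
    exact le_mul_of_one_le_left (by positivity) this
  set w : ℕ → ℝ := fun k => G * D * (τ ^ p * σ k ^ (1 - p)) with hw
  have hw0 : ∀ k, 0 ≤ w k := fun k => by
    have := hσ0 k
    simp only [hw]
    positivity
  set W : ℕ → ℝ := fun j => ∑ k ∈ Finset.range (n + 2), w k * barrier α (σ k) (t j) with hW
  have hW0 : W 0 = 0 := by
    simp only [hW, ht.zero]
    exact Finset.sum_eq_zero fun k _ => by rw [barrier_zero (hσ0 k), mul_zero]
  have key := abs_le_of_abs_l1Sum_le (W := W) hα0.le hα1 ht hV hW0.ge hmN fun i hi him => by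
    have hti : 0 < t i := ht.pos hi (by omega)
    have hτi : τ ≤ t i := ht.le hi (by omega)
    obtain ⟨k, hk1, hk2⟩ := exists_nat_pow_near ((one_le_div hτ).2 hτi) one_lt_two
    have hkn : k + 1 < n + 2 := by
      have h1 : (2 : ℝ) ^ k < 2 ^ (n + 1) := hk1.trans_lt (lt_of_le_of_lt
        (div_le_div_of_nonneg_right (ht.le him hmN) hτ.le) hn)
      have := (pow_lt_pow_iff_right₀ (one_lt_two : (1 : ℝ) < 2)).1 h1
      omega
    rw [le_div_iff₀ hτ] at hk1
    rw [div_lt_iff₀ hτ] at hk2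
    have hs1 : t i ≤ σ (k + 1) := by
      simp only [hσ]
      nlinarith [mul_le_mul_of_nonneg_right hΛ
        (by positivity : (0 : ℝ) ≤ 2 ^ (k + 1) * τ)]
    have hs2 : σ (k + 1) ≤ 2 * Λ * t i := by
      simp only [hσ, pow_succ]
      calc 2 ^ k * 2 * Λ * τ = 2 * Λ * (2 ^ k * τ) := by ring
        _ ≤ _ := by gcongr
    set s := σ (k + 1) with hs
    have hs0 : 0 < s := hσ0 _
    have hlow : D * (τ / t i) ^ p ≤ w (k + 1) * l1Sum α t (fun j => barrier α s (t j)) i := by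
      rw [l1Sum_barrier_of_le hα1 ht (by omega) hs1]
      have e1 : w (k + 1) * (s ^ (α - 2) * (t i ^ (1 - α) / (1 - α))) =
          (2 * Λ) ^ (p + (1 - α)) * D * ((τ / s) ^ p * (t i / s) ^ (1 - α)) := by
        have a1 : s ^ (1 - p) * s ^ (α - 2) = (s ^ p)⁻¹ * (s ^ (1 - α))⁻¹ := by
          rw [← Real.rpow_neg hs0.le, ← Real.rpow_neg hs0.le, ← Real.rpow_add hs0,
            ← Real.rpow_add hs0]
          congr 1; ring
        rw [Real.div_rpow hτ.le hs0.le, Real.div_rpow hti.le hs0.le]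
        calc w (k + 1) * (s ^ (α - 2) * (t i ^ (1 - α) / (1 - α)))
            = (2 * Λ) ^ (p + (1 - α)) * D * τ ^ p * t i ^ (1 - α) *
              (s ^ (1 - p) * s ^ (α - 2)) := by
              simp only [hw, hG, ← hs]
              field_simp
          _ = _ := by rw [a1]; ring
      have e2 : τ / t i / (2 * Λ) ≤ τ / s := by
        rw [div_div]
        exact div_le_div_of_nonneg_left hτ.le hs0 (by linarith)
      have e3 : 1 / (2 * Λ) ≤ t i / s := by
        rw [div_le_div_iff₀ (by positivity) hs0]
        linarith
      rw [e1]
      calc D * (τ / t i) ^ p = (2 * Λ) ^ (p + (1 - α)) * D *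
            ((τ / t i / (2 * Λ)) ^ p * (1 / (2 * Λ)) ^ (1 - α)) := by
            rw [Real.div_rpow (x := τ / t i) (by positivity) (by positivity),
              Real.div_rpow (x := 1) (by norm_num) (by positivity), Real.one_rpow,
              Real.rpow_add (by positivity)]
            have := Real.rpow_pos_of_pos (by positivity : 0 < 2 * Λ) p
            have := Real.rpow_pos_of_pos (by positivity : 0 < 2 * Λ) (1 - α)
            field_simp
        _ ≤ _ := by gcongr
    refine (h i hi him).trans (hlow.trans ?_)
    rw [hW, l1Sum_sum]
    simp only [l1Sum_const_mul]
    exact Finset.single_le_sum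
      (f := fun k => w k * l1Sum α t (fun j => barrier α (σ k) (t j)) i)
      (fun k _ => mul_nonneg (hw0 k) (hB T N t (σ k) ht hg (hΛσ k) i hi (by omega)))
      (Finset.mem_range.2 hkn)
  refine key.trans ?_
  simp only [hW]
  rw [Finset.mul_sum]
  refine Finset.sum_le_sum fun k _ => ?_
  have e1 : w k = G * Λ ^ (1 - p) * D * τ * ((2 : ℝ) ^ (1 - p)) ^ k := by
    have a1 : τ ^ p * τ ^ (1 - p) = τ := by
      rw [← Real.rpow_add hτ, add_sub_cancel, Real.rpow_one]
    have a2 : ((2 : ℝ) ^ k) ^ (1 - p) = ((2 : ℝ) ^ (1 - p)) ^ k := by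
      rw [← Real.rpow_natCast, ← Real.rpow_natCast, ← Real.rpow_mul (by norm_num),
        ← Real.rpow_mul (by norm_num), mul_comm]
    simp only [hw, hσ]
    rw [Real.mul_rpow (by positivity) hτ.le, Real.mul_rpow (by positivity) hΛ0.le, a2]
    linear_combination G * D * Λ ^ (1 - p) * ((2 : ℝ) ^ (1 - p)) ^ k * a1
  calc w k * barrier α (σ k) (t m) ≤ w k * t m ^ (α - 1) :=
        mul_le_mul_of_nonneg_left (barrier_le hα1 htm) (hw0 k)
    _ = _ := by rw [e1]; ring

/-- The stability bound, with `q = (2 - α) / r`, in terms of the first node `τ`. -/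
theorem exists_stability_bound {α θ p C : ℝ} (hα0 : 0 < α) (hα1 : α < 1)
    (hθ0 : 0 < θ) (hθ : θ ≤ 1) (hp : p = min ((2 - α) * θ) (1 + α / 2)) (hC : 1 ≤ C) :
    ∃ S, 0 ≤ S ∧ ∀ (T : ℝ) (N : ℕ) (t V : ℕ → ℝ) (D : ℝ), IsMesh T N t →
      HasGradedSteps θ C N t → 0 ≤ D → V 0 = 0 → ∀ m : ℕ, 1 ≤ m → m ≤ N →
        (∀ i, 1 ≤ i → i ≤ m → |l1Sum α t V i| ≤ D * (t 1 / t i) ^ p) →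
        |V m| ≤ S * D *
          (if 1 < (2 - α) * θ then t 1 * t m ^ (α - 1)
          else if (2 - α) * θ = 1 then t 1 * t m ^ (α - 1) * (1 + Real.log (t m / t 1))
          else t 1 ^ ((2 - α) * θ) * t m ^ (α - (2 - α) * θ)) := by
  set q := (2 - α) * θ with hq
  have hq0 : 0 < q := mul_pos (by linarith) hθ0
  have hp0 : 0 ≤ p := by rw [hp]; exact le_min hq0.le (by linarith)
  rcases le_or_gt q α with hqα | hqα
  · have hpq : p = q := by rw [hp]; exact min_eq_left (by linarith)
    refine ⟨1, zero_le_one, fun T N t V D ht _ hD hV m hm hmN h => ?_⟩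
    rw [if_neg (by linarith), if_neg (by linarith), one_mul, ← hpq]
    exact abs_le_of_l1Sum_le_of_le hα0.le hα1 (hpq.trans_le hqα) ht hD hV hm hmN h
  obtain ⟨S, hS, hdy⟩ := exists_dyadic_stability_bound (C := C) hα0 hα1 hθ0.le hθ hqα hp0 hC
  have common : ∀ (T : ℝ) (N : ℕ) (t : ℕ → ℝ) (m : ℕ), IsMesh T N t → 1 ≤ m → m ≤ N →
      0 < t 1 ∧ 0 < t m ∧
        ∃ n : ℕ, (2 : ℝ) ^ n ≤ t m / t 1 ∧ t m / t 1 < 2 ^ (n + 1) := by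
    intro T N t m ht hm hmN
    have hτ : 0 < t 1 := ht.pos le_rfl (by omega)
    exact ⟨hτ, ht.pos hm hmN,
      exists_nat_pow_near ((one_le_div hτ).2 (ht.le hm hmN)) one_lt_two⟩
  rcases lt_trichotomy q 1 with hq1 | hq1 | hq1
  · have hpq : p = q := by rw [hp]; exact min_eq_left (by linarith)
    set ρ := (2 : ℝ) ^ (1 - p) with hρ
    have hρ1 : 1 < ρ := Real.one_lt_rpow one_lt_two (by linarith)
    have hρ0 : 0 < ρ - 1 := by linarith
    refine ⟨S * (ρ ^ 2 / (ρ - 1)), by positivity, fun T N t V D ht hg hD hV m hm hmN h => ?_⟩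
    obtain ⟨hτ, htm, n, hn1, hn2⟩ := common T N t m ht hm hmN
    rw [if_neg (by linarith), if_neg (by linarith), ← hpq]
    have hsum : ∑ k ∈ Finset.range (n + 2), ρ ^ k ≤
        ρ ^ 2 / (ρ - 1) * (t m / t 1) ^ (1 - p) := by
      have h1 : ρ ^ n ≤ (t m / t 1) ^ (1 - p) := by
        have h2 := Real.rpow_le_rpow (by positivity) hn1 (by linarith : 0 ≤ 1 - p)
        rwa [← Real.rpow_natCast, ← Real.rpow_mul (by norm_num), mul_comm,
          Real.rpow_mul (by norm_num), Real.rpow_natCast] at h2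
      rw [geom_sum_eq hρ1.ne', pow_add, div_mul_eq_mul_div]
      have : ρ ^ n * ρ ^ 2 ≤ ρ ^ 2 * (t m / t 1) ^ (1 - p) := by
        rw [mul_comm]; gcongr
      gcongr
      linarith
    refine (hdy T N t V D ht hg hD hV m n hm hmN hn2 h).trans ?_
    calc _ ≤ S * D * (t 1 * t m ^ (α - 1)) * (ρ ^ 2 / (ρ - 1) * (t m / t 1) ^ (1 - p)) := by
          gcongr
      _ = S * (ρ ^ 2 / (ρ - 1)) * D * (t 1 ^ p * t m ^ (α - p)) := by
          have e1 : t m ^ (α - 1) * t m ^ (1 - p) = t m ^ (α - p) := by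
            rw [← Real.rpow_add htm]; congr 1; ring
          have e2 : t 1 / t 1 ^ (1 - p) = t 1 ^ p := by
            nth_rewrite 1 [← Real.rpow_one (t 1)]
            rw [← Real.rpow_sub hτ]; congr 1; ring
          rw [Real.div_rpow htm.le hτ.le, ← e1, ← e2]
          ring
  · have hp1 : p = 1 := by rw [hp, hq1]; exact min_eq_left (by linarith)
    have hlog2 : 0 < Real.log 2 := Real.log_pos one_lt_two
    refine ⟨S * (2 + 1 / Real.log 2), by positivity, fun T N t V D ht hg hD hV m hm hmN h => ?_⟩
    obtain ⟨hτ, htm, n, hn1, hn2⟩ := common T N t m ht hm hmN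
    rw [if_neg (by linarith), if_pos hq1]
    have hn : (n : ℝ) * Real.log 2 ≤ Real.log (t m / t 1) := by
      rw [← Real.log_pow]
      exact Real.log_le_log (by positivity) hn1
    have hL : 0 ≤ Real.log (t m / t 1) := le_trans (by positivity) hn
    have hsum : ∑ k ∈ Finset.range (n + 2), ((2 : ℝ) ^ (1 - p)) ^ k ≤
        (2 + 1 / Real.log 2) * (1 + Real.log (t m / t 1)) := by
      have h1 : (n : ℝ) ≤ 1 / Real.log 2 * Real.log (t m / t 1) := by
        rw [one_div_mul_eq_div]
        exact (le_div_iff₀ hlog2).2 hn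
      have h2 : 0 < 1 / Real.log 2 := by positivity
      rw [hp1]
      simp only [sub_self, Real.rpow_zero, one_pow, Finset.sum_const, Finset.card_range,
        nsmul_eq_mul, mul_one]
      push_cast
      nlinarith
    refine (hdy T N t V D ht hg hD hV m n hm hmN hn2 h).trans ?_
    calc _ ≤ S * D * (t 1 * t m ^ (α - 1)) *
          ((2 + 1 / Real.log 2) * (1 + Real.log (t m / t 1))) := by gcongr
      _ = _ := by ring
  · have hp1 : 1 < p := by rw [hp]; exact lt_min hq1 (by linarith)
    set ρ := (2 : ℝ) ^ (1 - p) with hρ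
    have hρ1 : ρ < 1 := Real.rpow_lt_one_of_one_lt_of_neg one_lt_two (by linarith)
    have hρ0 : 0 < ρ := by positivity
    have hρ' : 0 < 1 - ρ := by linarith
    refine ⟨S * (1 - ρ)⁻¹, by positivity, fun T N t V D ht hg hD hV m hm hmN h => ?_⟩
    obtain ⟨hτ, htm, n, hn1, hn2⟩ := common T N t m ht hm hmN
    rw [if_pos hq1]
    have hsum : ∑ k ∈ Finset.range (n + 2), ρ ^ k ≤ (1 - ρ)⁻¹ := by
      rw [← tsum_geometric_of_lt_one hρ0.le hρ1]
      exact (summable_geometric_of_lt_one hρ0.le hρ1).sum_le_tsum _ fun k _ => by positivity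
    refine (hdy T N t V D ht hg hD hV m n hm hmN hn2 h).trans ?_
    calc _ ≤ S * D * (t 1 * t m ^ (α - 1)) * (1 - ρ)⁻¹ := by gcongr
      _ = _ := by ring

/-! ### Quasi-graded submeshes and the regularity of the solution -/

theorem IsQuasiGraded.one_le {r c T : ℝ} {M : ℕ} {s : ℕ → ℝ} (hs : IsQuasiGraded r c T M s)
    (hT : 0 < T) : 1 ≤ M := by
  by_contra h
  obtain rfl : M = 0 := by omega
  exact hT.ne (hs.isMesh.zero.symm.trans hs.isMesh.last)

theorem IsQuasiGraded.one_le_const {r c T : ℝ} {M : ℕ} {s : ℕ → ℝ}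
    (hs : IsQuasiGraded r c T M s) (hT : 0 < T) : 1 ≤ c := by
  have hM := hs.one_le hT
  have h1 : 0 < s 1 := hs.isMesh.pos le_rfl hM
  have hM' : (0 : ℝ) < (M : ℝ) ^ (-r) := Real.rpow_pos_of_pos (by exact_mod_cast hM) _
  obtain ⟨h2, h3⟩ := hs.first
  have hc : 0 < c := by
    by_contra hc
    nlinarith
  by_contra hc1
  nlinarith

/-- A step of the refined mesh lies in an interval `[s k, s (k + 1)]`, `k ≥ 1`, of the quasi-graded
mesh, and the endpoints of the latter are comparable. -/
theorem IncludesQuasiGraded.hasGradedSteps {r c T : ℝ} {M N : ℕ} {t : ℕ → ℝ} (hr : 1 ≤ r)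
    (hT : 0 < T) (h : IncludesQuasiGraded r c T M N t) :
    HasGradedSteps (1 / r) (c * (c ^ 2 * 2 ^ r)) N t := by
  obtain ⟨ht, s, hs, hs1, hst⟩ := h
  have hM := hs.one_le hT
  have hc := hs.one_le_const hT
  have hr0 : 0 < r := by linarith
  set R := c ^ 2 * 2 ^ r with hR
  have hR1 : 1 ≤ R := by
    have : (1 : ℝ) ≤ 2 ^ r := Real.one_le_rpow one_le_two hr0.le
    nlinarith
  have key : ∀ j, 1 ≤ j → j < N → ∃ b, t (j + 1) ≤ b ∧ b ≤ R * t j ∧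
      t (j + 1) - t j ≤ c * (t 1 ^ (1 / r) * b ^ (1 - 1 / r)) := by
    intro j hj hjN
    classical
    set k := Nat.findGreatest (fun k => s k ≤ t j) M with hk
    have hP1 : s 1 ≤ t j := hs1.trans_le (ht.le hj hjN.le)
    have hk1 : 1 ≤ k := Nat.le_findGreatest hM hP1
    have hkP : s k ≤ t j := Nat.findGreatest_spec (P := fun k => s k ≤ t j) hM hP1
    have hkM : k < M := by
      refine lt_of_le_of_ne (Nat.findGreatest_le M) fun hkM => ?_
      rw [hkM, hs.isMesh.last, ← ht.last] at hkP
      exact absurd hkP (not_le.2 (ht.lt hjN le_rfl))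
    have hk' : t j < s (k + 1) :=
      not_le.1 (Nat.findGreatest_is_greatest (P := fun k => s k ≤ t j) (Nat.lt_succ_self k) hkM)
    have hjs : t (j + 1) ≤ s (k + 1) := by
      obtain ⟨i, hiN, hi⟩ := hst (k + 1) hkM
      rw [hi] at hk' ⊢
      have : j < i := by
        by_contra hij
        exact absurd hk' (not_lt.2 (ht.le (not_lt.1 hij) hjN.le))
      exact ht.le this hiN
    refine ⟨s (k + 1), hjs, ?_, ?_⟩
    · have h1 := (hs.node (k + 1) (by omega) hkM).1
      have h2 := (hs.node k hk1 hkM.le).2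
      have hs10 : 0 < s 1 := hs.isMesh.pos le_rfl hM
      have h3 : ((k + 1 : ℕ) : ℝ) ^ r ≤ 2 ^ r * (k : ℝ) ^ r := by
        rw [← Real.mul_rpow (by norm_num) (by positivity)]
        have : (1 : ℝ) ≤ k := by exact_mod_cast hk1
        refine Real.rpow_le_rpow (by positivity) ?_ hr0.le
        push_cast
        linarith
      calc s (k + 1) ≤ c * (s 1 * ((k + 1 : ℕ) : ℝ) ^ r) := h1
        _ ≤ c * (s 1 * (2 ^ r * (k : ℝ) ^ r)) := by gcongr
        _ = c * 2 ^ r * (s 1 * (k : ℝ) ^ r) := by ring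
        _ ≤ c * 2 ^ r * (c * s k) := by gcongr
        _ = R * s k := by rw [hR]; ring
        _ ≤ R * t j := by gcongr
    · have h1 := (hs.step (k + 1) (by omega) hkM).1
      rw [Nat.add_sub_cancel, hs1] at h1
      linarith
  refine ⟨fun j hj hjN => ?_, fun j hj hjN => ?_⟩
  · obtain ⟨b, h1, h2, -⟩ := key j hj hjN
    have h3 : 0 < t j := ht.pos hj hjN.le
    nlinarith [mul_pos (by linarith : 0 < R) h3]
  · obtain ⟨b, h1, h2, h3⟩ := key j hj hjN
    have hτ : 0 < t 1 := ht.pos le_rfl (by omega)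
    have htj : 0 < t j := ht.pos hj hjN.le
    have hb0 : 0 < b := (ht.pos (by omega) hjN).trans_le h1
    have hr1 : 0 ≤ 1 - 1 / r := sub_nonneg.2 ((div_le_one hr0).2 hr)
    have h4 : b ^ (1 - 1 / r) ≤ R * t j ^ (1 - 1 / r) := by
      calc b ^ (1 - 1 / r) ≤ (R * t j) ^ (1 - 1 / r) := Real.rpow_le_rpow hb0.le h2 hr1
        _ = R ^ (1 - 1 / r) * t j ^ (1 - 1 / r) := Real.mul_rpow (by linarith) htj.le
        _ ≤ R * t j ^ (1 - 1 / r) := by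
          have : R ^ (1 - 1 / r) ≤ R ^ (1 : ℝ) :=
            Real.rpow_le_rpow_of_exponent_le hR1 (by linarith [one_div_pos.2 hr0])
          rw [Real.rpow_one] at this
          gcongr
    calc t (j + 1) - t j ≤ c * (t 1 ^ (1 / r) * b ^ (1 - 1 / r)) := h3
      _ ≤ c * (t 1 ^ (1 / r) * (R * t j ^ (1 - 1 / r))) := by gcongr
      _ = _ := by
        rw [Real.div_rpow hτ.le htj.le, Real.rpow_sub htj, Real.rpow_one]
        ring

theorem HasDerivBounds.hasWeakSingularity {α K T : ℝ} {u : ℝ → ℝ} (hα1 : α < 1) (hT : 0 < T)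
    (h : HasDerivBounds α K T u) :
    HasWeakSingularity α (|K| * (1 + T ^ (1 - α) + T ^ (2 - α))) T u := by
  have hnhds : ∀ x ∈ Ioo 0 T, Ioc 0 T ∈ nhds x := fun x hx => Ioc_mem_nhds hx.1 hx.2
  have hd : ∀ x ∈ Ioo 0 T, derivWithin u (Ioc 0 T) x = deriv u x := fun x hx =>
    derivWithin_of_mem_nhds (hnhds x hx)
  have hee : ∀ x ∈ Ioo 0 T, derivWithin u (Ioc 0 T) =ᶠ[nhds x] deriv u := fun x hx => by
    filter_upwards [isOpen_Ioo.mem_nhds hx] with y hy using hd y hy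
  -- the constant term of the bound is absorbed by the singular one
  have hbound : ∀ l : ℕ, (l = 1 ∨ l = 2) → ∀ x ∈ Ioo 0 T,
      |iteratedDerivWithin l u (Ioc 0 T) x| ≤
        |K| * (1 + T ^ (1 - α) + T ^ (2 - α)) * x ^ (α - l) := by
    intro l hl x hx
    have hx0 := hx.1
    refine (h.bound l hl x ⟨hx.1, hx.2.le⟩).trans ?_
    have hl1 : 0 < (l : ℝ) - α := by rcases hl with rfl | rfl <;> norm_num <;> linarith
    have h1 : 1 ≤ T ^ ((l : ℝ) - α) * x ^ (α - l) := by
      calc (1 : ℝ) = x ^ ((l : ℝ) - α) * x ^ (α - l) := by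
            rw [← Real.rpow_add hx0, sub_add_sub_cancel, sub_self, Real.rpow_zero]
        _ ≤ _ := by
            have := Real.rpow_le_rpow hx0.le hx.2.le hl1.le
            gcongr
    have h2 : T ^ ((l : ℝ) - α) ≤ T ^ (1 - α) + T ^ (2 - α) := by
      have a1 : 0 ≤ T ^ (1 - α) := by positivity
      have a2 : 0 ≤ T ^ (2 - α) := by positivity
      rcases hl with rfl | rfl
      · push_cast; linarith
      · push_cast; linarith
    have h3 : 0 < x ^ (α - l) := by positivity
    rw [mul_assoc]
    refine mul_le_mul (le_abs_self K) ?_ (by positivity) (abs_nonneg K)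
    nlinarith
  refine ⟨h.cont, fun x hx => ?_, fun x hx => ?_, fun x hx => ?_, fun x hx => ?_⟩
  · exact ((h.diff x ⟨hx.1, hx.2.le⟩).differentiableAt (hnhds x hx)).differentiableWithinAt
  · have := hbound 1 (Or.inl rfl) x hx
    rwa [iteratedDerivWithin_one, hd x hx, Nat.cast_one] at this
  · exact (((h.diff' x ⟨hx.1, hx.2.le⟩).differentiableAt (hnhds x hx)).congr_of_eventuallyEq
      (hee x hx).symm).differentiableWithinAt
  · have := hbound 2 (Or.inr rfl) x hx
    rwa [iteratedDerivWithin_succ, iteratedDerivWithin_one,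
      derivWithin_of_mem_nhds (hnhds x hx), (hee x hx).deriv_eq, Nat.cast_ofNat] at this

/-- The stability bound in terms of the first node is a multiple of the error bound in terms of
the number of intervals. -/
theorem node_bound_le_errorBound {α r c τ x : ℝ} {M : ℕ} (hα1 : α < 1) (hr : 1 ≤ r)
    (hM : 1 ≤ M) (hc : 1 ≤ c) (hτ : 0 < τ) (hτx : τ ≤ x) (hτM : τ ≤ c * (M : ℝ) ^ (-r)) :
    (if 1 < (2 - α) * (1 / r) then τ * x ^ (α - 1)
      else if (2 - α) * (1 / r) = 1 then τ * x ^ (α - 1) * (1 + Real.log (x / τ))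
      else τ ^ ((2 - α) * (1 / r)) * x ^ (α - (2 - α) * (1 / r))) ≤
      (c + c ^ ((2 - α) * (1 / r))) * errorBound α r M τ x := by
  have hr0 : 0 < r := by linarith
  have hx : 0 < x := hτ.trans_le hτx
  have hM0 : (0 : ℝ) < M := by exact_mod_cast hM
  have hlog : 0 ≤ Real.log (x / τ) := Real.log_nonneg ((one_le_div hτ).2 hτx)
  have hcq : 0 < c ^ ((2 - α) * (1 / r)) := Real.rpow_pos_of_pos (by linarith) _
  have hcle : c ≤ c + c ^ ((2 - α) * (1 / r)) := by linarith
  have hdiv : (2 - α) * (1 / r) = (2 - α) / r := by ring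
  unfold errorBound
  rcases lt_trichotomy r (2 - α) with h | h | h
  · rw [if_pos h, if_pos (by rw [hdiv]; exact (one_lt_div hr0).2 h), ← mul_assoc]
    have : τ ≤ (c + c ^ ((2 - α) * (1 / r))) * (M : ℝ) ^ (-r) :=
      hτM.trans (by gcongr)
    gcongr
  · have h1 : (2 - α) * (1 / r) = 1 := by rw [hdiv, ← h, div_self hr0.ne']
    rw [if_neg h.not_lt, if_pos h, if_neg (by rw [h1]; exact lt_irrefl 1), if_pos h1,
      ← mul_assoc, ← mul_assoc]
    have : τ ≤ (c + c ^ ((2 - α) * (1 / r))) * (M : ℝ) ^ (α - 2) := by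
      refine hτM.trans ?_
      rw [show α - 2 = -r by linarith]
      gcongr
    gcongr
  · have h1 : (2 - α) * (1 / r) < 1 := by rw [hdiv]; exact (div_lt_one hr0).2 h
    rw [if_neg h.not_gt, if_neg h.ne', if_neg h1.not_gt, if_neg h1.ne, ← hdiv, ← mul_assoc]
    have hq : 0 ≤ (2 - α) * (1 / r) := mul_nonneg (by linarith) (by positivity)
    have : τ ^ ((2 - α) * (1 / r)) ≤ (c + c ^ ((2 - α) * (1 / r))) * (M : ℝ) ^ (α - 2) := by
      calc τ ^ ((2 - α) * (1 / r)) ≤ (c * (M : ℝ) ^ (-r)) ^ ((2 - α) * (1 / r)) :=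
            Real.rpow_le_rpow hτ.le hτM hq
        _ = c ^ ((2 - α) * (1 / r)) * (M : ℝ) ^ (α - 2) := by
            rw [Real.mul_rpow (by linarith) (by positivity), ← Real.rpow_mul hM0.le]
            congr 2
            field_simp
            ring
        _ ≤ _ := by
            gcongr
            linarith
    gcongr

theorem IsQuasiGraded.includesQuasiGraded {r c T : ℝ} {M : ℕ} {t : ℕ → ℝ}
    (h : IsQuasiGraded r c T M t) : IncludesQuasiGraded r c T M M t :=
  ⟨h.isMesh, t, h, rfl, fun k hk => ⟨k, hk, rfl⟩⟩

end L1Scheme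

theorem theorem3p1 (α r T c K : ℝ) (hα0 : 0 < α) (hα1 : α < 1) (hr : 1 ≤ r) (hT : 0 < T) :
    ∃ C : ℝ, ∀ (M N : ℕ) (t : ℕ → ℝ) (u f : ℝ → ℝ) (u₀ : ℝ) (U : ℕ → ℝ),
      ((N = M ∧ L1Scheme.IsQuasiGraded r c T M t) ∨
        L1Scheme.IncludesQuasiGraded r c T M N t) →
      L1Scheme.HasDerivBounds α K T u →
      (∀ x ∈ Set.Ioc 0 T, L1Scheme.caputo α u x = f x) → u 0 = u₀ →
      (∀ m, 1 ≤ m → m ≤ N → L1Scheme.discreteCaputo α t U m = f (t m)) → U 0 = u₀ →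
      ∀ m, 1 ≤ m → m ≤ N →
        |u (t m) - U m| ≤ C * L1Scheme.errorBound α r M (t 1) (t m) := by
  -- meshes with `c < 1` do not exist
  rcases lt_or_ge c 1 with hc | hc
  · refine ⟨0, fun M N t u f u₀ U hmesh => ?_⟩
    have : 1 ≤ c := by
      rcases hmesh with ⟨-, h⟩ | ⟨-, s, h, -⟩
      · exact h.one_le_const hT
      · exact h.one_le_const hT
    exact absurd this (not_le.2 hc)
  have hr0 : 0 < r := by linarith
  have hθ0 : 0 < 1 / r := by positivity
  have hθ1 : 1 / r ≤ 1 := (div_le_one hr0).2 hr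
  have hC : 1 ≤ c * (c ^ 2 * 2 ^ r) := by
    have h1 : (1 : ℝ) ≤ 2 ^ r := Real.one_le_rpow one_le_two hr0.le
    exact one_le_mul_of_one_le_of_one_le hc
      (one_le_mul_of_one_le_of_one_le (one_le_pow₀ hc) h1)
  have hA : 0 ≤ |K| * (1 + T ^ (1 - α) + T ^ (2 - α)) := by positivity
  obtain ⟨D, hD, htrunc⟩ := L1Scheme.exists_truncation_bound
    (p := min ((2 - α) * (1 / r)) (1 + α / 2)) hα0 hα1 hθ0.le hθ1 (min_le_left _ _)
    ((min_le_right _ _).trans_lt (by linarith)) hC hA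
  obtain ⟨S, hS, hstab⟩ := L1Scheme.exists_stability_bound hα0 hα1 hθ0 hθ1 rfl hC
  refine ⟨S * D * (c + c ^ ((2 - α) * (1 / r))), ?_⟩
  intro M N t u f u₀ U hmesh hu hf hu0 hU hU0 m hm hmN
  have hinc : L1Scheme.IncludesQuasiGraded r c T M N t := by
    rcases hmesh with ⟨rfl, h⟩ | h
    · exact h.includesQuasiGraded
    · exact h
  have hg := hinc.hasGradedSteps hr hT
  obtain ⟨ht, s, hs, hs1, -⟩ := hinc
  -- the error is mapped to the truncation error by the L1 operator
  have hres : ∀ i, 1 ≤ i → i ≤ N →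
      |L1Scheme.l1Sum α t (fun j => u (t j) - U j) i| ≤
        D * (t 1 / t i) ^ min ((2 - α) * (1 / r)) (1 + α / 2) := by
    intro i hi hiN
    have hti : t i ∈ Set.Ioc 0 T := ⟨ht.pos hi hiN, by rw [← ht.last]; exact ht.le hiN le_rfl⟩
    have h1 := (hU i hi hiN).trans (hf (t i) hti).symm
    have hΓ : 1 / Real.Gamma (1 - α) ≠ 0 :=
      one_div_ne_zero (Real.Gamma_pos_of_pos (by linarith)).ne'
    rw [L1Scheme.discreteCaputo_eq] at h1
    rw [L1Scheme.l1Sum_sub α t (fun j => u (t j)) U, mul_left_cancel₀ hΓ h1]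
    exact htrunc T N t u ht hg (hu.hasWeakSingularity hα1 hT) i hi hiN
  have h0 : u (t 0) - U 0 = 0 := by rw [ht.zero, hu0, hU0, sub_self]
  refine (hstab T N t (fun j => u (t j) - U j) D ht hg hD h0 m hm hmN
    fun i hi him => hres i hi (him.trans hmN)).trans ?_
  rw [mul_assoc (S * D)]
  refine mul_le_mul_of_nonneg_left ?_ (by positivity)
  refine L1Scheme.node_bound_le_errorBound hα1 hr (hs.one_le hT) hc (ht.pos le_rfl (by omega))
    (ht.le hm hmN) ?_
  rw [← hs1]
  exact hs.first.1
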